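/- Let $d\in\mathbb N$ and $\mathbb T^d=(\mathbb R/2\pi\mathbb Z)^d$, let $\varphi_k(x)=(2\pi)^{-d/2}e^{ik\cdot x}$ for $k\in\mathbb Z^d$, let $L^2=L^2(\mathbb T^d,\mathbb R)$, and let $H^1=\{f\in L^2:\sum_{k}|k|^2|\langle f,\varphi_k\rangle|^2<\infty\}$ with $\|f\|_{H^1}^2=\|f\|_{L^2}^2+\sum_k|k|^2|\langle f,\varphi_k\rangle|^2$. Set $(\mu_0,\dots,\mu_{2d})=(1,\cos x_1,\sin x_1,\dots,\cos x_d,\sin x_d)$ and consider the bilinear wave equation $$\partial_t^2 w(x,t)=\Big(\Delta+\sum_{j=0}^{2d}p_j(t)\mu_j(x)\Big)w(x,t),\qquad x\in\mathbb T^d,$$ with control $p=(p_0,\dots,p_{2d})$. Its solution on $[0,T]$ with initial state $(w_0,\dot w_0)\in H^1\times L^2$ is the function $W=(w,\partial_t w)\in C^0([0,T],H^1\times L^2)$ such that, for all $t\in[0,T]$, $$W(t)=e^{t\mathcal A}(w_0,\dot w_0)+\int_0^t e^{(t-s)\mathcal A}\Big(0,\ \sum_{j=0}^{2d}p_j(s)\mu_j\,w(s)\Big)\,ds,$$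 where $e^{t\mathcal A}$ is the group generated by $\mathcal A=\begin{pmatrix}0&I\\ \Delta&0\end{pmatrix}$ on $H^1\times L^2$, that is, the solution operator of the free wave equation. Let $(0,0)\neq(w_0,\dot w_0)\in H^1\times L^2$ be such that either $w_0\neq0$ and $\langle w_0,e^{ik\cdot x}\rangle_{L^2}=0$ for all but finitely many $k\in\mathbb Z^d$, or $w_0=0$, $\dot w_0\neq0$ and $\langle\dot w_0,e^{ik\cdot x}\rangle_{L^2}=0$ for all but finitely many $k\in\mathbb Z^d$. Then for every $(w_1,\dot w_1)\in H^1\times L^2$, every $\varepsilon>0$ and every $T>0$ there is a piecewise constant control $p:[0,T]\to\mathbb R^{2d+1}$ for which the solution $(w,\partial_t w)$ on $[0,T]$ with initial state $(w_0,\dot w_0)$ exists, is unique, and satisfies $$\big\|(w(T),\partial_t w(T))-(w_1,\dot w_1)\big\|_{H^1\times L^2}<\varepsilon .$$ -/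

import Mathlib

open MeasureTheory Set
open scoped ENNReal ComplexConjugate

noncomputable section

namespace BilinearWave

instance fact_two_pi_pos : Fact (0 < 2 * Real.pi) := ⟨Real.two_pi_pos⟩

/-- The torus `𝕋^d = (ℝ / 2πℤ)^d`; its `volume` is Lebesgue measure, of total mass `(2π)^d`. -/
abbrev Torus (d : ℕ) : Type := Fin d → AddCircle (2 * Real.pi)

/-- The real Hilbert space `L²(𝕋^d, ℝ)`. -/
abbrev L2 (d : ℕ) : Type := Lp ℝ 2 (volume : Measure (Torus d))

/-- The eigenfunctions `φ_k(x) = (2π)^{-d/2} e^{ikx}` of the Laplacian. -/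
def eigenfunction {d : ℕ} (k : Fin d → ℤ) : C(Torus d, ℂ) where
  toFun x := (((2 * Real.pi) ^ (-(d : ℝ) / 2) : ℝ) : ℂ) * ∏ i, fourier (k i) (x i)
  continuous_toFun := by fun_prop

/-- The eigenvalues `λ_k = |k|²` of `-Δ`. -/
def eigenvalue {d : ℕ} (k : Fin d → ℤ) : ℝ := ∑ i, (k i : ℝ) ^ 2

/-- The Fourier coefficient `⟨f, φ_k⟩`, where `⟨f, g⟩ = ∫ f(x) conj(g(x)) dx`. -/
def coeff {d : ℕ} (f : L2 d) (k : Fin d → ℤ) : ℂ :=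
  ∫ x, (f x : ℂ) * conj (eigenfunction k x)

/-- `f` has only finitely many non-vanishing Fourier modes. -/
def HasFinitelyManyModes {d : ℕ} (f : L2 d) : Prop :=
  {k : Fin d → ℤ | coeff f k ≠ 0}.Finite

lemma integrable_coeff {d : ℕ} (f : L2 d) (k : Fin d → ℤ) :
    Integrable (fun x => (f x : ℂ) * conj (eigenfunction k x)) := by
  have hf : Integrable (fun x => (f x : ℂ)) :=
    ((Lp.memLp f).integrable (by norm_num)).ofReal
  refine hf.mul_bdd (c := ‖eigenfunction k‖) ?_ ?_
  · exact (by fun_prop : Continuous fun x => conj (eigenfunction k x)).aestronglyMeasurable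
  · exact Filter.Eventually.of_forall fun x => by
      simpa using (eigenfunction k).norm_coe_le_norm x

lemma coeff_add {d : ℕ} (f g : L2 d) (k : Fin d → ℤ) :
    coeff (f + g) k = coeff f k + coeff g k := by
  unfold coeff
  rw [← integral_add (integrable_coeff f k) (integrable_coeff g k)]
  refine integral_congr_ae ?_
  filter_upwards [Lp.coeFn_add f g] with x hx
  rw [hx]
  simp [add_mul]

lemma coeff_smul {d : ℕ} (c : ℝ) (f : L2 d) (k : Fin d → ℤ) :
    coeff (c • f) k = c * coeff f k := by
  unfold coeff
  rw [← integral_const_mul]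
  refine integral_congr_ae ?_
  filter_upwards [Lp.coeFn_smul c f] with x hx
  rw [hx]
  simp [mul_assoc]

/-- Membership in `H¹(𝕋^d, ℝ)`: the sequence `|k| ⟨f, φ_k⟩` is square summable. -/
def h1Submodule (d : ℕ) : Submodule ℝ (L2 d) where
  carrier := {f | Memℓp (fun k : Fin d → ℤ => (Real.sqrt (eigenvalue k) : ℂ) * coeff f k) 2}
  zero_mem' := by
    have h : ∀ k, coeff (0 : L2 d) k = 0 := fun k => by
      simpa using coeff_smul 0 (0 : L2 d) k
    refine cast (congrArg (fun u => Memℓp u 2) ?_)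
      (zero_memℓp : Memℓp (0 : (k : Fin d → ℤ) → ℂ) 2)
    funext k
    simp [h]
  add_mem' := by
    intro f g hf hg
    have h := Memℓp.add hf hg
    refine cast (congrArg (fun u => Memℓp u 2) ?_) h
    funext k
    simp [coeff_add, mul_add]
  smul_mem' := by
    intro c f hf
    have h := Memℓp.const_smul hf (c : ℂ)
    refine cast (congrArg (fun u => Memℓp u 2) ?_) h
    funext k
    simp only [Pi.smul_apply, smul_eq_mul, coeff_smul]
    ring

/-- The membership condition is the usual one, `∑ λ_k |⟨f, φ_k⟩|² < ∞`. -/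
lemma mem_h1Submodule_iff {d : ℕ} (f : L2 d) :
    f ∈ h1Submodule d ↔ Summable fun k : Fin d → ℤ => eigenvalue k * ‖coeff f k‖ ^ 2 := by
  change Memℓp _ 2 ↔ _
  rw [memℓp_gen_iff (by norm_num)]
  refine summable_congr fun k => ?_
  have hk : 0 ≤ eigenvalue k := Finset.sum_nonneg fun i _ => sq_nonneg _
  simp [mul_pow, Real.sq_sqrt hk]

/-- The Sobolev space `H¹(𝕋^d, ℝ)`, with the norm introduced below. -/
def H1 (d : ℕ) : Type := h1Submodule d

instance (d : ℕ) : AddCommGroup (H1 d) := inferInstanceAs (AddCommGroup (h1Submodule d))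

instance (d : ℕ) : Module ℝ (H1 d) := inferInstanceAs (Module ℝ (h1Submodule d))

/-- The inclusion `H¹ ⊆ L²`. -/
def toL2 {d : ℕ} : H1 d →ₗ[ℝ] L2 d := (h1Submodule d).subtype

/-- The square summable sequence `|k| ⟨f, φ_k⟩`. -/
def gradCoeff {d : ℕ} : H1 d →ₗ[ℝ] lp (fun _ : Fin d → ℤ => ℂ) 2 where
  toFun f := ⟨fun k => (Real.sqrt (eigenvalue k) : ℂ) * coeff (toL2 f) k, f.2⟩
  map_add' f g := by
    ext k
    simp only [map_add, coeff_add, mul_add]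
    rfl
  map_smul' c f := by
    ext k
    simp only [map_smul, coeff_smul, RingHom.id_apply, lp.coeFn_smul, Pi.smul_apply,
      Complex.real_smul]
    ring

/-- The map `f ↦ (f, (|k| ⟨f, φ_k⟩)_k)`, through which `H¹` is normed. -/
def h1Embedding {d : ℕ} : H1 d →ₗ[ℝ] WithLp 2 (L2 d × lp (fun _ : Fin d → ℤ => ℂ) 2) :=
  (WithLp.linearEquiv 2 ℝ (L2 d × lp (fun _ : Fin d → ℤ => ℂ) 2)).symm.toLinearMap ∘ₗ
    toL2.prod gradCoeff

lemma h1Embedding_injective {d : ℕ} : Function.Injective (h1Embedding (d := d)) := by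
  intro f g h
  have h2 : toL2 f = toL2 g := congrArg (fun z => z.ofLp.1) h
  exact Subtype.ext h2

instance (d : ℕ) : NormedAddCommGroup (H1 d) :=
  NormedAddCommGroup.induced (H1 d) _ h1Embedding h1Embedding_injective

instance (d : ℕ) : NormedSpace ℝ (H1 d) := NormedSpace.induced ℝ (H1 d) _ h1Embedding

/-- `‖f‖²_{H¹} = ‖f‖²_{L²} + ∑ λ_k |⟨f, φ_k⟩|²`. -/
lemma H1.norm_sq {d : ℕ} (f : H1 d) :
    ‖f‖ ^ 2 = ‖toL2 f‖ ^ 2 + ∑' k : Fin d → ℤ, eigenvalue k * ‖coeff (toL2 f) k‖ ^ 2 := by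
  have h : ‖f‖ ^ 2 = ‖h1Embedding f‖ ^ 2 := rfl
  rw [h, WithLp.prod_norm_sq_eq_of_L2]
  congr 1
  have h2 : ‖gradCoeff f‖ ^ 2 = ∑' k, ‖gradCoeff f k‖ ^ 2 := by
    simpa using lp.norm_rpow_eq_tsum (p := 2) (by norm_num) (gradCoeff f)
  refine h2.trans (tsum_congr fun k => ?_)
  have hk : 0 ≤ eigenvalue k := Finset.sum_nonneg fun i _ => sq_nonneg _
  simp [gradCoeff, mul_pow, Real.sq_sqrt hk]

/-- The real function `Re (a φ_k)`. -/
def modeFun {d : ℕ} (a : ℂ) (k : Fin d → ℤ) : C(Torus d, ℝ) where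
  toFun x := (a * eigenfunction k x).re
  continuous_toFun := by fun_prop

/-- `Re (a φ_k)` as an element of `L²`. -/
def modeL2 {d : ℕ} (a : ℂ) (k : Fin d → ℤ) : L2 d := ContinuousMap.toLp 2 volume ℝ (modeFun a k)

lemma coeff_eq_inner {d : ℕ} (f : L2 d) (k : Fin d → ℤ) :
    coeff f k = (inner ℝ (modeL2 1 k) f : ℝ) -
      Complex.I * (inner ℝ (modeL2 (-Complex.I) k) f : ℝ) := by
  have hm : ∀ a : ℂ, (inner ℝ (modeL2 a k) f : ℝ) =
      ((∫ x, f x * (a * eigenfunction k x).re) : ℝ) := by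
    intro a
    rw [L2.inner_def]
    refine integral_congr_ae ?_
    filter_upwards [ContinuousMap.coeFn_toLp (𝕜 := ℝ) (p := 2) volume (modeFun a k)] with x hx
    have hx' : (modeL2 a k) x = (a * eigenfunction k x).re := hx
    simp [hx']
  have hi := integrable_coeff f k
  rw [hm, hm]
  apply Complex.ext
  · have := integral_re hi
    simp only [RCLike.re_eq_complex_re] at this
    simp [coeff, ← this]
  · have := integral_im hi
    simp only [RCLike.im_eq_complex_im] at this
    simp [coeff, ← this, integral_neg]

lemma continuous_coeff {d : ℕ} (k : Fin d → ℤ) : Continuous fun f : L2 d => coeff f k := by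
  simp_rw [coeff_eq_inner]
  fun_prop

/-- `H¹` is complete, so that Bochner integrals in `H¹ × L²` have their usual meaning. -/
instance (d : ℕ) : CompleteSpace (H1 d) := by
  have hu : IsUniformInducing (h1Embedding (d := d)) := ⟨rfl⟩
  rw [completeSpace_iff_isComplete_range hu]
  apply IsClosed.isComplete
  have hr : Set.range (h1Embedding (d := d)) =
      {z | ∀ k, z.snd k = (Real.sqrt (eigenvalue k) : ℂ) * coeff z.fst k} := by
    ext z
    constructor
    · rintro ⟨f, rfl⟩ k
      rfl
    · intro hz
      have hz' : z.fst ∈ h1Submodule d := by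
        change Memℓp _ 2
        rw [← funext hz]
        exact lp.memℓp z.snd
      refine ⟨⟨z.fst, hz'⟩, ?_⟩
      apply (WithLp.linearEquiv 2 ℝ (L2 d × lp (fun _ : Fin d → ℤ => ℂ) 2)).injective
      refine Prod.ext rfl ?_
      ext k
      exact (hz k).symm
  rw [hr, Set.ofPred_forall]
  refine isClosed_iInter fun k => isClosed_eq ?_ ?_
  · have h1 : Continuous fun y : lp (fun _ : Fin d → ℤ => ℂ) 2 => y k :=
      (lp.evalCLM ℂ (fun _ : Fin d → ℤ => ℂ) 2 k).continuous
    exact h1.comp (WithLp.prod_continuous_ofLp 2 _ _).snd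
  · exact continuous_const.mul ((continuous_coeff k).comp (WithLp.prod_continuous_ofLp 2 _ _).fst)

/-- The state space `H¹ × L²(𝕋^d, ℝ)` of pairs (profile, velocity). -/
abbrev State (d : ℕ) : Type := H1 d × L2 d

/-- The Hilbert norm of `H¹ × L²`. -/
def stateNorm {d : ℕ} (W : State d) : ℝ := Real.sqrt (‖W.1‖ ^ 2 + ‖W.2‖ ^ 2)

lemma integral_prod_fourier {d : ℕ} (n : Fin d → ℤ) (hn : n ≠ 0) :
    ∫ x : Torus d, ∏ i, (fourier (n i) (x i) : ℂ) = 0 := by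
  obtain ⟨i, hi⟩ := Function.ne_iff.mp hn
  rw [integral_fintype_prod_volume_eq_prod (fun i (y : AddCircle (2 * Real.pi)) =>
    (fourier (n i) y : ℂ))]
  exact Finset.prod_eq_zero (Finset.mem_univ i)
    (integral_eq_zero_of_add_right_eq_neg (fourier_add_half_inv_index hi Real.two_pi_pos))

lemma coeff_modeL2 {d : ℕ} (a : ℂ) (k j : Fin d → ℤ) (h1 : j ≠ k) (h2 : j ≠ -k) :
    coeff (modeL2 a k) j = 0 := by
  set r : ℂ := (((2 * Real.pi) ^ (-(d : ℝ) / 2) : ℝ) : ℂ) with hr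
  have e : ∀ x : Torus d, (((a * eigenfunction k x).re : ℝ) : ℂ) * conj (eigenfunction j x) =
      a * r ^ 2 / 2 * ∏ i, (fourier ((k - j) i) (x i) : ℂ) +
        conj a * r ^ 2 / 2 * ∏ i, (fourier ((-k - j) i) (x i) : ℂ) := by
    intro x
    have hc : conj r = r := Complex.conj_ofReal _
    rw [Complex.re_eq_add_conj]
    simp only [eigenfunction, ContinuousMap.coe_mk, map_mul, map_prod, ← hr, hc, ← fourier_neg,
      Pi.sub_apply, Pi.neg_apply, sub_eq_add_neg, fourier_add, Finset.prod_mul_distrib]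
    ring
  have hi : ∀ n : Fin d → ℤ, Integrable fun x : Torus d => ∏ i, (fourier (n i) (x i) : ℂ) :=
    fun n => (by fun_prop : Continuous fun x : Torus d =>
      ∏ i, (fourier (n i) (x i) : ℂ)).integrable_of_hasCompactSupport
        (HasCompactSupport.of_compactSpace _)
  have hx : coeff (modeL2 a k) j =
      ∫ x : Torus d, (((a * eigenfunction k x).re : ℝ) : ℂ) * conj (eigenfunction j x) := by
    refine integral_congr_ae ?_
    filter_upwards [ContinuousMap.coeFn_toLp (𝕜 := ℝ) (p := 2) volume (modeFun a k)] with x hx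
    have hx' : (modeL2 a k) x = (a * eigenfunction k x).re := hx
    simp only [hx']
  rw [hx, integral_congr_ae (Filter.Eventually.of_forall e),
    integral_add ((hi _).const_mul _) ((hi _).const_mul _), integral_const_mul,
    integral_const_mul, integral_prod_fourier _ (sub_ne_zero.mpr (Ne.symm h1)),
    integral_prod_fourier _ (sub_ne_zero.mpr (Ne.symm h2))]
  simp

/-- `Re (a φ_k)` as an element of `H¹`. -/
def modeH1 {d : ℕ} (a : ℂ) (k : Fin d → ℤ) : H1 d :=
  ⟨modeL2 a k, by
    rw [mem_h1Submodule_iff]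
    refine summable_of_ne_finset_zero (s := {k, -k}) fun j hj => ?_
    simp only [Finset.mem_insert, Finset.mem_singleton, not_or] at hj
    simp [coeff_modeL2 a k j hj.1 hj.2]⟩

/-- The free evolution `e^{t𝒜}`, `𝒜 (w, v) = (v, Δ w)`, through its Fourier series. The factor
`t * sinc (√λ t)` is `sin (√λ t) / √λ` for `λ ≠ 0` and `t` for `λ = 0`. As `w` and `v` are
real-valued, the terms of index `k` and `-k` are conjugate, so that taking real parts does not
change the sums. The series converge in `H¹` and in `L²`. -/
def freeEvolution {d : ℕ} (t : ℝ) (W : State d) : State d :=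
  (∑' k : Fin d → ℤ, modeH1
      (coeff (toL2 W.1) k * (Real.cos (Real.sqrt (eigenvalue k) * t) : ℝ) +
        coeff W.2 k * (t * Real.sinc (Real.sqrt (eigenvalue k) * t) : ℝ)) k,
    ∑' k : Fin d → ℤ, modeL2
      (-(Real.sqrt (eigenvalue k) : ℝ) * coeff (toL2 W.1) k *
          (Real.sin (Real.sqrt (eigenvalue k) * t) : ℝ) +
        coeff W.2 k * (Real.cos (Real.sqrt (eigenvalue k) * t) : ℝ)) k)

/-- The control modes `(μ_0, …, μ_{2d}) = (1, cos x_1, sin x_1, …, cos x_d, sin x_d)`. -/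
def controlMode {d : ℕ} (j : Fin (2 * d + 1)) : C(Torus d, ℝ) :=
  Fin.cases 1 (fun m : Fin (2 * d) =>
    let i : Fin d := ⟨m.val / 2, by omega⟩
    if m.val % 2 = 0 then
      ⟨fun x => Real.Angle.cos (x i), Real.Angle.continuous_cos.comp (continuous_apply i)⟩
    else
      ⟨fun x => Real.Angle.sin (x i), Real.Angle.continuous_sin.comp (continuous_apply i)⟩) j

/-- The potential `∑_j p_j μ_j(x)` for given control values `p_j`. -/
def potential {d : ℕ} (p : Fin (2 * d + 1) → ℝ) : C(Torus d, ℝ) := ∑ j, p j • controlMode j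

/-- Multiplication of an `L²` function by a continuous function. -/
def mulL2 {d : ℕ} (V : C(Torus d, ℝ)) (f : L2 d) : L2 d :=
  MemLp.toLp (fun x => V x * f x) ((Lp.memLp f).of_le_mul (c := ‖V‖)
    (V.continuous.aestronglyMeasurable.mul (Lp.aestronglyMeasurable f))
    (Filter.Eventually.of_forall fun x => by
      rw [norm_mul]
      exact mul_le_mul_of_nonneg_right (V.norm_coe_le_norm x) (norm_nonneg _)))

/-- The bounded operator `(w, v) ↦ (0, V w)`, that is, `V ℬ`. -/
def controlOp {d : ℕ} (V : C(Torus d, ℝ)) (W : State d) : State d := (0, mulL2 V (toL2 W.1))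

/-- `W = (w, ∂_t w)` solves `∂_t² w = (Δ + ∑_j p_j(t) μ_j(x)) w` on `[0, T]` with `W(0) = W₀`:
it is continuous into `H¹ × L²` and satisfies the Duhamel formula there. -/
def IsSolution {d : ℕ} (T : ℝ) (p : ℝ → Fin (2 * d + 1) → ℝ) (W₀ : State d) (W : ℝ → State d) :
    Prop :=
  ContinuousOn W (Icc 0 T) ∧
  ∀ t ∈ Icc (0 : ℝ) T,
    IntervalIntegrable (fun s => freeEvolution (t - s) (controlOp (potential (p s)) (W s)))
      volume 0 t ∧
    W t = freeEvolution t W₀ +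
      ∫ s in (0 : ℝ)..t, freeEvolution (t - s) (controlOp (potential (p s)) (W s))

/-- `p` is piecewise constant on `[0, T]`: it is constant on the intervals `[t_i, t_{i+1})` of a
subdivision `0 = t_0 < … < t_N = T`. -/
def IsPiecewiseConstant {X : Type*} (T : ℝ) (p : ℝ → X) : Prop :=
  ∃ (N : ℕ) (t : Fin (N + 1) → ℝ), StrictMono t ∧ t 0 = 0 ∧ t (Fin.last N) = T ∧
    ∀ i : Fin N, ∃ c, ∀ s ∈ Ico (t i.castSucc) (t i.succ), p s = c

end BilinearWave

end

open BilinearWave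

/-! A control of size 1/δ acting for a time δ becomes, as δ → 0, the impulse (w, v) ↦ (w, v + φ w),
because K (w, v) = (0, φ w) satisfies K² = 0 (`tendsto_mildFlow_impulse`). Impulses compose
additively. Moreover, a free evolution of duration δ framed by the impulses of δ^(-1/2) φ and
-δ^(-1/2) φ tends to the impulse of -φ² (`tendsto_conjugated_freeCLM`): the first impulse creates a
velocity δ^(-1/2) φ w, which displaces the profile by about δ^(1/2) φ w, and the second impulse
turns this displacement into the velocity -φ² w. Up to constants, a trigonometric function of
frequency k + m is a sum of two negative squares of functions with frequencies k and m
(`two_smul_trigMode_add`), so the given control modes generate impulses for all trigonometric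
polynomials.

A nonzero profile w with finitely many modes vanishes almost nowhere, hence the products φ w are
dense in L² and the velocity can be changed at will while the profile stays fixed
(`steersTo_velocity`). The profile is moved by the free evolution: between two profiles with
finitely many modes the required initial velocity is found mode by mode, the divisors sin(|k|δ)/|k|
being nonzero for small δ (`eventually_exists_velocity`). Adjusting the velocity before and after
gives `steersTo_of_profile`. If the initial profile is zero, a short free evolution first converts
the velocity into a profile.

All this takes arbitrarily little time. To arrive exactly at time T, the state is brought quickly
near the free backward evolution of the target and then left alone (`exists_control_of_steersTo`).
The analytic basis is that `freeCLM` is a strongly continuous group, whose bounded perturbations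
have unique mild solutions depending Lipschitz continuously on the initial state; this is what
allows approximate steps to be chained (`SteersTo.trans`). -/

noncomputable section

namespace BilinearWave

variable {d : ℕ}

/-! ### Fourier series on the torus -/

/-- The character `x ↦ e^{ikx}`. -/
def character (k : Fin d → ℤ) : C(Torus d, ℂ) where
  toFun x := ∏ i, fourier (k i) (x i)
  continuous_toFun := by fun_prop

lemma character_apply (k : Fin d → ℤ) (x : Torus d) :
    character k x = ∏ i, (fourier (k i) (x i) : ℂ) := rfl

lemma character_neg (k : Fin d → ℤ) (x : Torus d) : character (-k) x = conj (character k x) := by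
  simp only [character_apply, Pi.neg_apply, fourier_neg, map_prod]

lemma character_add (k m : Fin d → ℤ) (x : Torus d) :
    character (k + m) x = character k x * character m x := by
  simp only [character_apply, Pi.add_apply, fourier_add, Finset.prod_mul_distrib]

lemma character_zero (x : Torus d) : character (0 : Fin d → ℤ) x = 1 := by
  simp [character_apply]

lemma norm_character (k : Fin d → ℤ) (x : Torus d) : ‖character k x‖ = 1 := by
  rw [character_apply, norm_prod]
  exact Finset.prod_eq_one fun i _ => Circle.norm_coe _

lemma character_single (i : Fin d) (x : Torus d) :
    character (Pi.single i 1) x = fourier 1 (x i) := by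
  rw [character_apply, Finset.prod_eq_single i]
  · simp
  · intro j _ hj
    simp [Pi.single_eq_of_ne hj]
  · simp

lemma integral_character (k : Fin d → ℤ) :
    ∫ x : Torus d, character k x = if k = 0 then ((2 * Real.pi) ^ d : ℂ) else 0 := by
  split_ifs with h
  · subst h
    have hv : (volume : Measure (Torus d)).real univ = (2 * Real.pi) ^ d := by
      rw [Measure.real, volume_pi, Measure.pi_univ]
      simp only [AddCircle.measure_univ, Finset.prod_const, Finset.card_univ, Fintype.card_fin,
        ENNReal.toReal_pow, ENNReal.toReal_ofReal Real.two_pi_pos.le]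
    simp [character_zero, hv]
  · exact integral_prod_fourier k h

/-- The normalisation constant `(2π)^{-d/2}`. -/
def modeScale (d : ℕ) : ℝ := (2 * Real.pi) ^ (-(d : ℝ) / 2)

lemma modeScale_pos (d : ℕ) : 0 < modeScale d := Real.rpow_pos_of_pos Real.two_pi_pos _

lemma modeScale_sq (d : ℕ) : modeScale d ^ 2 * (2 * Real.pi) ^ d = 1 := by
  rw [modeScale, ← Real.rpow_natCast, ← Real.rpow_natCast, ← Real.rpow_mul Real.two_pi_pos.le,
    ← Real.rpow_add Real.two_pi_pos]
  norm_num

lemma eigenfunction_apply (k : Fin d → ℤ) (x : Torus d) :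
    eigenfunction k x = modeScale d * character k x := rfl

lemma integral_eigenfunction_mul_conj (k j : Fin d → ℤ) :
    ∫ x : Torus d, eigenfunction k x * conj (eigenfunction j x) = if k = j then 1 else 0 := by
  have e : ∀ x : Torus d, eigenfunction k x * conj (eigenfunction j x) =
      (modeScale d : ℂ) ^ 2 * character (k - j) x := by
    intro x
    rw [sub_eq_add_neg, character_add, character_neg, eigenfunction_apply, eigenfunction_apply,
      map_mul, Complex.conj_ofReal]
    ring
  simp_rw [e]
  rw [integral_const_mul, integral_character]
  simp only [sub_eq_zero]
  split_ifs
  · exact_mod_cast modeScale_sq d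
  · simp

/-- The star subalgebra of trigonometric polynomials. -/
def characterSubalgebra (d : ℕ) : StarSubalgebra ℂ C(Torus d, ℂ) where
  toSubalgebra := Algebra.adjoin ℂ (range character)
  star_mem' := by
    change Algebra.adjoin ℂ (range character) ≤ star (Algebra.adjoin ℂ (range character))
    refine Algebra.adjoin_le ?_
    rintro _ ⟨n, rfl⟩
    refine Algebra.subset_adjoin ⟨-n, ?_⟩
    ext1 x
    simp only [character_neg, starRingEnd_apply, ContinuousMap.star_apply]

/-- Products of characters are characters, so generating an algebra adds nothing to the linear span.
-/
lemma characterSubalgebra_toSubmodule :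
    (characterSubalgebra d).toSubalgebra.toSubmodule = Submodule.span ℂ (range character) := by
  apply Algebra.adjoin_eq_span_of_subset
  refine .trans (fun x ↦ Submonoid.closure_induction (fun _ ↦ id) ⟨0, ?_⟩ ?_)
    Submodule.subset_span
  · ext z
    simp [character_zero]
  · rintro _ _ _ _ ⟨m, rfl⟩ ⟨n, rfl⟩
    refine ⟨m + n, ?_⟩
    ext z
    simp [character_add]

lemma characterSubalgebra_separatesPoints : (characterSubalgebra d).SeparatesPoints := by
  intro x y hxy
  obtain ⟨i, hi⟩ := Function.ne_iff.mp hxy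
  refine ⟨_, ⟨character (Pi.single i 1), Algebra.subset_adjoin ⟨Pi.single i 1, rfl⟩, rfl⟩, ?_⟩
  dsimp only
  rw [character_single, character_single, fourier_one, fourier_one]
  intro h
  exact hi (AddCircle.injective_toCircle Real.two_pi_pos.ne' (Circle.ext h))

/-- Stone–Weierstrass. -/
lemma span_character_closure_eq_top :
    (Submodule.span ℂ (range (character (d := d)))).topologicalClosure = ⊤ := by
  rw [← characterSubalgebra_toSubmodule]
  exact congr_arg (Subalgebra.toSubmodule <| StarSubalgebra.toSubalgebra ·)
    (ContinuousMap.starSubalgebra_topologicalClosure_eq_top_of_separatesPoints _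
      (characterSubalgebra_separatesPoints (d := d)))

/-- The eigenfunctions in the complex `L²` space. -/
def eigenfunctionLp (k : Fin d → ℤ) : Lp ℂ 2 (volume : Measure (Torus d)) :=
  ContinuousMap.toLp (E := ℂ) 2 volume ℂ (eigenfunction k)

lemma orthonormal_eigenfunctionLp : Orthonormal ℂ (eigenfunctionLp (d := d)) := by
  rw [orthonormal_iff_ite]
  intro m n
  simp only [eigenfunctionLp, ContinuousMap.inner_toLp]
  rw [integral_eigenfunction_mul_conj]
  simp [eq_comm]

lemma span_eigenfunction_eq :
    Submodule.span ℂ (range (eigenfunction (d := d))) = Submodule.span ℂ (range character) := by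
  have h : ∀ k : Fin d → ℤ, eigenfunction k = (modeScale d : ℂ) • character k := fun k => by
    ext x; rfl
  have h0 : (modeScale d : ℂ) ≠ 0 := by exact_mod_cast (modeScale_pos d).ne'
  apply le_antisymm
  · rw [Submodule.span_le]
    rintro _ ⟨k, rfl⟩
    rw [h]
    exact Submodule.smul_mem _ _ (Submodule.subset_span ⟨k, rfl⟩)
  · rw [Submodule.span_le]
    rintro _ ⟨k, rfl⟩
    have : character k = (modeScale d : ℂ)⁻¹ • eigenfunction k := by
      rw [h, smul_smul, inv_mul_cancel₀ h0, one_smul]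
    rw [this]
    exact Submodule.smul_mem _ _ (Submodule.subset_span ⟨k, rfl⟩)

lemma span_eigenfunctionLp_closure_eq_top :
    (Submodule.span ℂ (range (eigenfunctionLp (d := d)))).topologicalClosure = ⊤ := by
  have h0 : (Submodule.span ℂ (range (eigenfunction (d := d)))).topologicalClosure = ⊤ := by
    rw [span_eigenfunction_eq]
    exact span_character_closure_eq_top
  have := (ContinuousMap.toLp_denseRange ℂ (volume : Measure (Torus d)) ℂ
    (p := 2) (by simp)).topologicalClosure_map_submodule h0
  simpa only [Submodule.map_span, ContinuousLinearMap.coe_coe, ← range_comp, Function.comp_def]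
    using! this

/-- The Hilbert basis of the complex `L²` space given by the eigenfunctions. -/
def eigenBasis (d : ℕ) : HilbertBasis (Fin d → ℤ) ℂ (Lp ℂ 2 (volume : Measure (Torus d))) :=
  HilbertBasis.mk orthonormal_eigenfunctionLp span_eigenfunctionLp_closure_eq_top.ge

lemma eigenBasis_apply (k : Fin d → ℤ) : eigenBasis d k = eigenfunctionLp k := by
  rw [eigenBasis, HilbertBasis.coe_mk]

/-- The embedding of real into complex `L²` functions. -/
def complexify (d : ℕ) : L2 d →L[ℝ] Lp ℂ 2 (volume : Measure (Torus d)) :=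
  Complex.ofRealCLM.compLpL 2 volume

/-- The real part of a complex `L²` function. -/
def realPart (d : ℕ) : Lp ℂ 2 (volume : Measure (Torus d)) →L[ℝ] L2 d :=
  Complex.reCLM.compLpL 2 volume

lemma coeFn_complexify (f : L2 d) : ∀ᵐ x, complexify d f x = (f x : ℂ) :=
  Complex.ofRealCLM.coeFn_compLpL f

lemma coeFn_realPart (f : Lp ℂ 2 (volume : Measure (Torus d))) :
    ∀ᵐ x, realPart d f x = (f x).re := Complex.reCLM.coeFn_compLpL f

lemma norm_complexify (f : L2 d) : ‖complexify d f‖ = ‖f‖ := by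
  rw [Lp.norm_def, Lp.norm_def]
  congr 1
  refine eLpNorm_congr_norm_ae ?_
  filter_upwards [coeFn_complexify f] with x hx
  simp [hx]

/-- The bridge through which Parseval's identity and Fourier expansion pass from the complex Hilbert
basis to real functions. -/
lemma eigenBasis_repr_complexify (f : L2 d) (k : Fin d → ℤ) :
    (eigenBasis d).repr (complexify d f) k = coeff f k := by
  rw [HilbertBasis.repr_apply_apply, eigenBasis_apply, L2.inner_def]
  refine integral_congr_ae ?_
  filter_upwards [coeFn_complexify f,
    ContinuousMap.coeFn_toLp (𝕜 := ℂ) (p := 2) volume (eigenfunction k)] with x hx hy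
  simp only [eigenfunctionLp, hx, hy, RCLike.inner_apply]

/-- Parseval's identity. -/
lemma hasSum_norm_coeff_sq (f : L2 d) : HasSum (fun k => ‖coeff f k‖ ^ 2) (‖f‖ ^ 2) := by
  have h := lp.hasSum_norm (p := 2) (by norm_num) ((eigenBasis d).repr (complexify d f))
  simpa [eigenBasis_repr_complexify, norm_complexify] using h

lemma coeff_ext {f g : L2 d} (h : ∀ k, coeff f k = coeff g k) : f = g := by
  have h1 := hasSum_norm_coeff_sq (f - g)
  have h2 : ∀ k, coeff (f - g) k = 0 := fun k => by
    have := coeff_add (f - g) g k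
    rw [sub_add_cancel, h k] at this
    simpa using this.symm
  simp only [h2, norm_zero, ne_eq, OfNat.ofNat_ne_zero, not_false_eq_true, zero_pow] at h1
  have := h1.unique hasSum_zero
  rw [sq_eq_zero_iff, norm_eq_zero, sub_eq_zero] at this
  exact this

lemma coeff_zero (k : Fin d → ℤ) : coeff (0 : L2 d) k = 0 := by
  simpa using coeff_smul 0 (0 : L2 d) k

lemma coeff_sub (f g : L2 d) (k : Fin d → ℤ) : coeff (f - g) k = coeff f k - coeff g k := by
  have := coeff_add (f - g) g k
  rw [sub_add_cancel] at this
  rw [this, add_sub_cancel_right]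

lemma eigenfunction_neg (k : Fin d → ℤ) (x : Torus d) :
    eigenfunction (-k) x = conj (eigenfunction k x) := by
  simp [eigenfunction_apply, character_neg]

lemma coeff_neg_index (f : L2 d) (k : Fin d → ℤ) : coeff f (-k) = conj (coeff f k) := by
  rw [coeff, coeff, ← integral_conj]
  simp [eigenfunction_neg]

lemma coeFn_modeL2 (a : ℂ) (k : Fin d → ℤ) :
    ∀ᵐ x, modeL2 a k x = (a * eigenfunction k x).re :=
  ContinuousMap.coeFn_toLp (𝕜 := ℝ) (p := 2) volume (modeFun a k)

/-- Re (a φ_k) is half the sum of a φ_k and its conjugate, which has frequency -k. Both terms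
contribute when k = j = 0. -/
lemma coeff_modeL2_eq (a : ℂ) (k j : Fin d → ℤ) :
    coeff (modeL2 a k) j = (if k = j then a / 2 else 0) + (if k = -j then conj a / 2 else 0) := by
  have hx : coeff (modeL2 a k) j = ∫ x : Torus d,
      (a / 2 * (eigenfunction k x * conj (eigenfunction j x)) +
        conj a / 2 * (eigenfunction (-k) x * conj (eigenfunction j x))) := by
    refine integral_congr_ae ?_
    filter_upwards [coeFn_modeL2 a k] with x hx
    rw [hx, Complex.re_eq_add_conj, eigenfunction_neg, map_mul]
    ring
  have hi : ∀ m : Fin d → ℤ,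
      Integrable fun x : Torus d => eigenfunction m x * conj (eigenfunction j x) :=
    fun m => (by fun_prop : Continuous fun x : Torus d =>
      eigenfunction m x * conj (eigenfunction j x)).integrable_of_hasCompactSupport
        (HasCompactSupport.of_compactSpace _)
  rw [hx, integral_add ((hi _).const_mul _) ((hi _).const_mul _), integral_const_mul,
    integral_const_mul, integral_eigenfunction_mul_conj, integral_eigenfunction_mul_conj]
  simp [neg_eq_iff_eq_neg]

lemma realPart_smul_eigenfunctionLp (a : ℂ) (k : Fin d → ℤ) :
    realPart d (a • eigenfunctionLp k) = modeL2 a k := by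
  refine Lp.ext ?_
  filter_upwards [coeFn_realPart (a • eigenfunctionLp k), coeFn_modeL2 a k,
    Lp.coeFn_smul a (eigenfunctionLp k),
    ContinuousMap.coeFn_toLp (𝕜 := ℂ) (p := 2) volume (eigenfunction k)] with x h1 h2 h3 h4
  rw [h1, h2, h3, Pi.smul_apply, eigenfunctionLp, h4, smul_eq_mul]

/-- `f ↦ ⟨f, φ_k⟩` as a continuous linear map. -/
def coeffCLM (k : Fin d → ℤ) : L2 d →L[ℝ] ℂ where
  toFun f := coeff f k
  map_add' f g := coeff_add f g k
  map_smul' c f := by rw [coeff_smul, RingHom.id_apply, Complex.real_smul]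
  cont := continuous_coeff k

lemma coeffCLM_apply (k : Fin d → ℤ) (f : L2 d) : coeffCLM k f = coeff f k := rfl

/-- A sequence of Fourier coefficients of a real function: `c_{-k}` is conjugate to `c_k`. -/
def IsHermitianSeq (c : (Fin d → ℤ) → ℂ) : Prop := ∀ k, c (-k) = conj (c k)

/-- The two point masses that make up a mode sum up to the given Hermitian sequence. -/
lemma hasSum_two_point {c : (Fin d → ℤ) → ℂ} (hc : IsHermitianSeq c) (j : Fin d → ℤ) :
    HasSum (fun k => (if k = j then c k / 2 else 0) + (if k = -j then conj (c k) / 2 else 0))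
      (c j) := by
  have h1 : HasSum (fun k => if k = j then c k / 2 else 0) (c j / 2) := by
    simpa using hasSum_ite_eq j (c j / 2) |>.congr_fun (fun k => by split_ifs <;> simp_all)
  have h2 : HasSum (fun k => if k = -j then conj (c k) / 2 else 0) (c j / 2) := by
    have : conj (c (-j)) = c j := by rw [hc, Complex.conj_conj]
    rw [← this]
    simpa using hasSum_ite_eq (-j) (conj (c (-j)) / 2) |>.congr_fun
      (fun k => by split_ifs <;> simp_all)
  convert h1.add h2 using 1
  ring

/-- The series is the real part of the complex series ∑ c_k φ_k. Hermitian symmetry ensures that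
taking real parts does not alter the coefficients. -/
lemma exists_hasSum_modeL2 {c : (Fin d → ℤ) → ℂ} (hc : IsHermitianSeq c)
    (hs : Summable fun k => ‖c k‖ ^ 2) :
    ∃ f : L2 d, HasSum (fun k => modeL2 (c k) k) f ∧ ∀ k, coeff f k = c k := by
  have hm : Memℓp c 2 := by
    rw [memℓp_gen_iff (by norm_num)]
    simpa using hs
  have h := ((eigenBasis d).hasSum_repr_symm ⟨c, hm⟩).mapL (realPart d)
  simp only [eigenBasis_apply, realPart_smul_eigenfunctionLp] at h
  refine ⟨_, h, fun j => ?_⟩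
  have h2 := h.mapL (coeffCLM j)
  simp only [coeffCLM_apply, coeff_modeL2_eq] at h2
  exact h2.unique (hasSum_two_point hc j)

lemma isHermitianSeq_coeff (f : L2 d) : IsHermitianSeq (coeff f) := coeff_neg_index f

lemma hasSum_modeL2_coeff (f : L2 d) : HasSum (fun k => modeL2 (coeff f k) k) f := by
  obtain ⟨g, hg, hgc⟩ := exists_hasSum_modeL2 (isHermitianSeq_coeff f)
    (hasSum_norm_coeff_sq f).summable
  rwa [coeff_ext hgc] at hg

/-! ### Fourier series in `H¹` -/

lemma eigenvalue_nonneg (k : Fin d → ℤ) : 0 ≤ eigenvalue k :=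
  Finset.sum_nonneg fun _ _ => sq_nonneg _

lemma eigenvalue_neg (k : Fin d → ℤ) : eigenvalue (-k) = eigenvalue k := by
  simp [eigenvalue]

/-- Parseval's identity in `H¹`. -/
lemma H1.hasSum_norm_sq (f : H1 d) :
    HasSum (fun k => (1 + eigenvalue k) * ‖coeff (toL2 f) k‖ ^ 2) (‖f‖ ^ 2) := by
  rw [H1.norm_sq]
  have h1 := hasSum_norm_coeff_sq (toL2 f)
  have h2 : Summable fun k : Fin d → ℤ => eigenvalue k * ‖coeff (toL2 f) k‖ ^ 2 :=
    (mem_h1Submodule_iff (toL2 f)).mp f.2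
  simpa only [add_mul, one_mul] using h1.add h2.hasSum

lemma toL2_injective : Function.Injective (toL2 (d := d)) := Subtype.val_injective

lemma H1.coeff_ext {f g : H1 d} (h : ∀ k, coeff (toL2 f) k = coeff (toL2 g) k) : f = g :=
  toL2_injective (BilinearWave.coeff_ext h)

lemma norm_toL2_le (f : H1 d) : ‖toL2 f‖ ≤ ‖f‖ := by
  refine (sq_le_sq₀ (norm_nonneg _) (norm_nonneg f)).mp ?_
  rw [H1.norm_sq]
  exact le_add_of_nonneg_right (tsum_nonneg fun k => mul_nonneg (eigenvalue_nonneg k) (sq_nonneg _))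

/-- The inclusion of `H¹` into `L²` as a continuous linear map. -/
def toL2CLM (d : ℕ) : H1 d →L[ℝ] L2 d :=
  toL2.mkContinuous 1 fun f => by simpa using norm_toL2_le f

lemma toL2_modeH1 (a : ℂ) (k : Fin d → ℤ) : toL2 (modeH1 a k) = modeL2 a k := rfl

lemma gradCoeff_apply (f : H1 d) (k : Fin d → ℤ) :
    gradCoeff f k = (Real.sqrt (eigenvalue k) : ℂ) * coeff (toL2 f) k := rfl

lemma gradCoeff_modeH1 (a : ℂ) (k : Fin d → ℤ) :
    gradCoeff (modeH1 a k) = lp.single 2 k ((Real.sqrt (eigenvalue k) : ℂ) * a / 2) +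
      lp.single 2 (-k) ((Real.sqrt (eigenvalue k) : ℂ) * conj a / 2) := by
  ext j
  simp only [gradCoeff_apply, toL2_modeH1, coeff_modeL2_eq, lp.coeFn_add, Pi.add_apply,
    lp.single_apply, Pi.single_apply]
  have e1 : (k = j) ↔ (j = k) := eq_comm
  have e2 : (k = -j) ↔ (j = -k) := by rw [eq_neg_iff_add_eq_zero, eq_neg_iff_add_eq_zero, add_comm]
  simp only [e1, e2, mul_add]
  congr 1
  · split_ifs with h
    · rw [h]; ring
    · simp
  · split_ifs with h
    · rw [h, eigenvalue_neg]; ring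
    · simp

/-- The topology of `H1` is induced by `h1Embedding`, so it suffices to sum in L² and, for the
weighted coefficients, in ℓ². There the series is the average of the coordinate expansion and its
reindexing by k ↦ -k. -/
lemma hasSum_modeH1_of_coeff (f : H1 d) :
    HasSum (fun k => modeH1 (coeff (toL2 f) k) k) f := by
  have hi : Topology.IsInducing (h1Embedding (d := d)) := ⟨rfl⟩
  have hg : HasSum (fun k => gradCoeff (modeH1 (coeff (toL2 f) k) k)) (gradCoeff f) := by
    have h1 := (lp.hasSum_single (E := fun _ : Fin d → ℤ => ℂ) (p := 2) (by simp)
      (gradCoeff f)).const_smul (2⁻¹ : ℂ)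
    have h2 := (Equiv.neg (Fin d → ℤ)).hasSum_iff.mpr h1
    have h3 := h1.add h2
    rw [← add_smul] at h3
    norm_num at h3
    refine h3.congr_fun fun k => ?_
    rw [gradCoeff_modeH1]
    simp only [← lp.single_smul, smul_eq_mul, gradCoeff_apply,
      eigenvalue_neg, coeff_neg_index]
    congr 2 <;> ring
  have hl := hasSum_modeL2_coeff (toL2 f)
  have hp := hl.prodMk hg
  have hp2 := hp.mapL (WithLp.prodContinuousLinearEquiv 2 ℝ (L2 d)
    (lp (fun _ : Fin d → ℤ => ℂ) 2)).symm.toContinuousLinearMap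
  have hq : HasSum (fun k => h1Embedding (modeH1 (coeff (toL2 f) k) k)) (h1Embedding f) := hp2
  unfold HasSum at hq ⊢
  rw [hi.tendsto_nhds_iff]
  refine hq.congr fun s => ?_
  simp [map_sum]

lemma exists_hasSum_modeH1 {c : (Fin d → ℤ) → ℂ} (hc : IsHermitianSeq c)
    (hs : Summable fun k => (1 + eigenvalue k) * ‖c k‖ ^ 2) :
    ∃ f : H1 d, HasSum (fun k => modeH1 (c k) k) f ∧ ∀ k, coeff (toL2 f) k = c k := by
  have hn := fun k : Fin d → ℤ => eigenvalue_nonneg k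
  have hs1 : Summable fun k => ‖c k‖ ^ 2 := hs.of_nonneg_of_le (fun k => sq_nonneg _) fun k => by
    nlinarith [hn k, sq_nonneg ‖c k‖, mul_nonneg (hn k) (sq_nonneg ‖c k‖)]
  have hs2 : Summable fun k => eigenvalue k * ‖c k‖ ^ 2 :=
    hs.of_nonneg_of_le (fun k => mul_nonneg (hn k) (sq_nonneg _)) fun k => by
      nlinarith [hn k, sq_nonneg ‖c k‖]
  obtain ⟨f, -, hf⟩ := exists_hasSum_modeL2 hc hs1
  let F : H1 d := ⟨f, (mem_h1Submodule_iff f).mpr (by simpa only [hf] using hs2)⟩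
  have hF : ∀ k, coeff (toL2 F) k = c k := hf
  refine ⟨F, ?_, hF⟩
  simpa only [hF] using hasSum_modeH1_of_coeff F

lemma norm_add_sq_le_two_mul {E : Type*} [SeminormedAddCommGroup E] (a b : E) :
    ‖a + b‖ ^ 2 ≤ 2 * ‖a‖ ^ 2 + 2 * ‖b‖ ^ 2 := by
  have h := norm_add_le a b
  nlinarith [norm_nonneg (a + b), sq_nonneg (‖a‖ - ‖b‖)]

lemma norm_sub_sq_le_two_mul {E : Type*} [SeminormedAddCommGroup E] (a b : E) :
    ‖a - b‖ ^ 2 ≤ 2 * ‖a‖ ^ 2 + 2 * ‖b‖ ^ 2 := by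
  simpa [sub_eq_add_neg] using norm_add_sq_le_two_mul a (-b)

open Filter Topology in
/-- Dominated convergence of Fourier coefficients for a weighted square norm. -/
lemma tendsto_of_dominated_coeff {E : Type*} [SeminormedAddCommGroup E] (c : E → (Fin d → ℤ) → ℂ)
    (hsub : ∀ f g k, c (f - g) k = c f k - c g k) (r : (Fin d → ℤ) → ℝ) (hr : ∀ k, 0 ≤ r k)
    (hnorm : ∀ f, HasSum (fun k => r k * ‖c f k‖ ^ 2) (‖f‖ ^ 2))
    (F : ℝ → E) (t₀ : ℝ) (hF : ∀ k, ContinuousAt (fun t => c (F t) k) t₀)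
    (u : (Fin d → ℤ) → ℝ) (hu : Summable u)
    (hb : ∀ᶠ t in 𝓝 t₀, ∀ k, r k * ‖c (F t) k‖ ^ 2 ≤ u k) : ContinuousAt F t₀ := by
  have hb0 := hb.self_of_nhds
  have key : Tendsto (fun t => ∑' k, r k * ‖c (F t) k - c (F t₀) k‖ ^ 2) (𝓝 t₀)
      (𝓝 (∑' _ : Fin d → ℤ, (0 : ℝ))) := by
    -- The factor 4 comes from |a - b|² ≤ 2|a|² + 2|b|², with both squares bounded after weighting
    -- by `u k`.
    refine tendsto_tsum_of_dominated_convergence (bound := fun k => 4 * u k) (hu.mul_left 4)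
      (fun k => ?_) ?_
    · have h : ContinuousAt (fun t => r k * ‖c (F t) k - c (F t₀) k‖ ^ 2) t₀ :=
        continuousAt_const.mul (((hF k).sub continuousAt_const).norm.pow 2)
      simpa [ContinuousAt] using h
    · filter_upwards [hb] with t ht k
      rw [Real.norm_of_nonneg (mul_nonneg (hr k) (sq_nonneg _))]
      have h1 := mul_le_mul_of_nonneg_left (norm_sub_sq_le_two_mul (c (F t) k) (c (F t₀) k)) (hr k)
      linarith [ht k, hb0 k]
  have key2 : Tendsto (fun t => ‖F t - F t₀‖ ^ 2) (𝓝 t₀) (𝓝 0) := by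
    rw [tsum_zero] at key
    refine key.congr fun t => ?_
    rw [← (hnorm (F t - F t₀)).tsum_eq]
    simp only [hsub]
  have key3 : Tendsto (fun t => ‖F t - F t₀‖) (𝓝 t₀) (𝓝 0) := by
    have := key2.sqrt
    simpa using this
  exact tendsto_iff_norm_sub_tendsto_zero.mpr key3

/-! ### The free evolution -/

/-- The multiplier `sin (√λ t) / √λ`. -/
def sineMultiplier (k : Fin d → ℤ) (t : ℝ) : ℝ := t * Real.sinc (Real.sqrt (eigenvalue k) * t)

/-- The multiplier `cos (√λ t)`. -/
def cosMultiplier (k : Fin d → ℤ) (t : ℝ) : ℝ := Real.cos (Real.sqrt (eigenvalue k) * t)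

/-- Valid also for λ = 0, where the multiplier is t; this avoids dividing by √λ in what follows. -/
lemma sqrt_mul_sineMultiplier (k : Fin d → ℤ) (t : ℝ) :
    Real.sqrt (eigenvalue k) * sineMultiplier k t = Real.sin (Real.sqrt (eigenvalue k) * t) := by
  unfold sineMultiplier
  by_cases h : Real.sqrt (eigenvalue k) * t = 0
  · rw [h, Real.sinc_zero, Real.sin_zero, mul_one, h]
  · rw [Real.sinc_of_ne_zero h, ← mul_assoc, mul_div_cancel₀ _ h]

lemma abs_sineMultiplier_le (k : Fin d → ℤ) (t : ℝ) : |sineMultiplier k t| ≤ |t| := by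
  rw [sineMultiplier, abs_mul]
  exact mul_le_of_le_one_right (abs_nonneg t) (Real.abs_sinc_le_one _)

lemma sineMultiplier_sq_le (k : Fin d → ℤ) (t : ℝ) : sineMultiplier k t ^ 2 ≤ t ^ 2 :=
  sq_le_sq.mpr (abs_sineMultiplier_le k t)

lemma eigenvalue_mul_sineMultiplier_sq (k : Fin d → ℤ) (t : ℝ) :
    eigenvalue k * sineMultiplier k t ^ 2 = Real.sin (Real.sqrt (eigenvalue k) * t) ^ 2 := by
  rw [← sqrt_mul_sineMultiplier, mul_pow, Real.sq_sqrt (eigenvalue_nonneg k)]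

lemma sineMultiplier_add (k : Fin d → ℤ) (s t : ℝ) : sineMultiplier k (s + t) =
    sineMultiplier k s * cosMultiplier k t + cosMultiplier k s * sineMultiplier k t := by
  by_cases h : Real.sqrt (eigenvalue k) = 0
  · simp [sineMultiplier, cosMultiplier, h]
  · apply mul_left_cancel₀ h
    rw [sqrt_mul_sineMultiplier, mul_add, Real.sin_add, ← sqrt_mul_sineMultiplier,
      ← sqrt_mul_sineMultiplier, cosMultiplier, cosMultiplier]
    ring

lemma cosMultiplier_add (k : Fin d → ℤ) (s t : ℝ) : cosMultiplier k (s + t) =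
    cosMultiplier k s * cosMultiplier k t -
      eigenvalue k * (sineMultiplier k s * sineMultiplier k t) := by
  have h := Real.sq_sqrt (eigenvalue_nonneg k)
  rw [cosMultiplier, mul_add, Real.cos_add, ← sqrt_mul_sineMultiplier, ← sqrt_mul_sineMultiplier]
  simp only [cosMultiplier]
  linear_combination (-sineMultiplier k s * sineMultiplier k t) * h

lemma continuous_sineMultiplier (k : Fin d → ℤ) : Continuous (sineMultiplier k) :=
  continuous_id.mul (Real.continuous_sinc.comp (continuous_const.mul continuous_id))

lemma continuous_cosMultiplier (k : Fin d → ℤ) : Continuous (cosMultiplier k) :=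
  Real.continuous_cos.comp (continuous_const.mul continuous_id)

lemma sineMultiplier_neg_index (k : Fin d → ℤ) (t : ℝ) :
    sineMultiplier (-k) t = sineMultiplier k t := by
  rw [sineMultiplier, sineMultiplier, eigenvalue_neg]

lemma cosMultiplier_neg_index (k : Fin d → ℤ) (t : ℝ) :
    cosMultiplier (-k) t = cosMultiplier k t := by
  rw [cosMultiplier, cosMultiplier, eigenvalue_neg]

lemma norm_ofReal_mul_sq (r : ℝ) (z : ℂ) : ‖(r : ℂ) * z‖ ^ 2 = r ^ 2 * ‖z‖ ^ 2 := by
  rw [norm_mul, mul_pow, Complex.norm_real, Real.norm_eq_abs, sq_abs]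

/-- The Fourier coefficients of the profile of the free evolution. -/
def profileCoeff (t : ℝ) (W : State d) (k : Fin d → ℤ) : ℂ :=
  cosMultiplier k t * coeff (toL2 W.1) k + sineMultiplier k t * coeff W.2 k

/-- The Fourier coefficients of the velocity of the free evolution. -/
def velocityCoeff (t : ℝ) (W : State d) (k : Fin d → ℤ) : ℂ :=
  -((eigenvalue k * sineMultiplier k t : ℝ) * coeff (toL2 W.1) k) +
    cosMultiplier k t * coeff W.2 k

/-- The sine multiplier gains one derivative: its square times 1 + λ is at most t² + 1. Hence a
velocity in L² produces a profile in H¹. -/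
lemma profileCoeff_bound (t : ℝ) (W : State d) (k : Fin d → ℤ) :
    (1 + eigenvalue k) * ‖profileCoeff t W k‖ ^ 2 ≤
      2 * ((1 + eigenvalue k) * ‖coeff (toL2 W.1) k‖ ^ 2) +
        2 * (1 + t ^ 2) * ‖coeff W.2 k‖ ^ 2 := by
  have hl := eigenvalue_nonneg k
  have h1 := norm_add_sq_le_two_mul (cosMultiplier k t * coeff (toL2 W.1) k)
    (sineMultiplier k t * coeff W.2 k)
  rw [norm_ofReal_mul_sq, norm_ofReal_mul_sq] at h1
  have h2 : cosMultiplier k t ^ 2 ≤ 1 := Real.cos_sq_le_one _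
  have h3 : (1 + eigenvalue k) * sineMultiplier k t ^ 2 ≤ 1 + t ^ 2 := by
    have := eigenvalue_mul_sineMultiplier_sq k t
    have := Real.sin_sq_le_one (Real.sqrt (eigenvalue k) * t)
    have := sineMultiplier_sq_le k t
    linarith
  have ha := sq_nonneg ‖coeff (toL2 W.1) k‖
  have hb := sq_nonneg ‖coeff W.2 k‖
  calc (1 + eigenvalue k) * ‖profileCoeff t W k‖ ^ 2
      ≤ (1 + eigenvalue k) * (2 * (cosMultiplier k t ^ 2 * ‖coeff (toL2 W.1) k‖ ^ 2) +
        2 * (sineMultiplier k t ^ 2 * ‖coeff W.2 k‖ ^ 2)) :=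
        mul_le_mul_of_nonneg_left h1 (by linarith)
    _ = 2 * ((1 + eigenvalue k) * (cosMultiplier k t ^ 2 * ‖coeff (toL2 W.1) k‖ ^ 2)) +
        2 * ((1 + eigenvalue k) * sineMultiplier k t ^ 2) * ‖coeff W.2 k‖ ^ 2 := by ring
    _ ≤ _ := by
      gcongr
      exact mul_le_of_le_one_left ha h2

lemma velocityCoeff_bound (t : ℝ) (W : State d) (k : Fin d → ℤ) :
    ‖velocityCoeff t W k‖ ^ 2 ≤ 2 * ((1 + eigenvalue k) * ‖coeff (toL2 W.1) k‖ ^ 2) +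
      2 * ‖coeff W.2 k‖ ^ 2 := by
  have hl := eigenvalue_nonneg k
  have h1 := norm_add_sq_le_two_mul (-((eigenvalue k * sineMultiplier k t : ℝ) *
    coeff (toL2 W.1) k)) (cosMultiplier k t * coeff W.2 k)
  rw [norm_neg, norm_ofReal_mul_sq, norm_ofReal_mul_sq] at h1
  have h2 : cosMultiplier k t ^ 2 ≤ 1 := Real.cos_sq_le_one _
  have h3 : (eigenvalue k * sineMultiplier k t) ^ 2 ≤ 1 + eigenvalue k := by
    have e1 := eigenvalue_mul_sineMultiplier_sq k t
    have e2 := Real.sin_sq_le_one (Real.sqrt (eigenvalue k) * t)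
    rw [mul_pow, sq (eigenvalue k), mul_assoc, e1]
    nlinarith
  have ha := sq_nonneg ‖coeff (toL2 W.1) k‖
  have hb := sq_nonneg ‖coeff W.2 k‖
  refine h1.trans ?_
  gcongr
  exact mul_le_of_le_one_left hb h2

lemma summable_profileCoeff_bound (C : ℝ) (W : State d) :
    Summable fun k => 2 * ((1 + eigenvalue k) * ‖coeff (toL2 W.1) k‖ ^ 2) +
      C * ‖coeff W.2 k‖ ^ 2 :=
  ((H1.hasSum_norm_sq W.1).summable.mul_left 2).add
    ((hasSum_norm_coeff_sq W.2).summable.mul_left _)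

lemma isHermitianSeq_profileCoeff (t : ℝ) (W : State d) : IsHermitianSeq (profileCoeff t W) := by
  intro k
  simp [profileCoeff, sineMultiplier_neg_index, cosMultiplier_neg_index, coeff_neg_index]

lemma isHermitianSeq_velocityCoeff (t : ℝ) (W : State d) :
    IsHermitianSeq (velocityCoeff t W) := by
  intro k
  simp [velocityCoeff, sineMultiplier_neg_index, cosMultiplier_neg_index, coeff_neg_index,
    eigenvalue_neg]

/-- The bound on the coefficients makes the defining series converge, so that its `tsum` is the true
sum and not the default value 0. From here on the free evolution is handled through its
coefficients. -/
lemma coeff_freeEvolution_fst (t : ℝ) (W : State d) (k : Fin d → ℤ) :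
    coeff (toL2 (freeEvolution t W).1) k = profileCoeff t W k := by
  obtain ⟨f, hf, hfc⟩ := exists_hasSum_modeH1 (isHermitianSeq_profileCoeff t W)
    ((summable_profileCoeff_bound _ W).of_nonneg_of_le (fun k => mul_nonneg
      (by linarith [eigenvalue_nonneg k]) (sq_nonneg _)) (profileCoeff_bound t W))
  have : (freeEvolution t W).1 = f := by
    rw [← hf.tsum_eq]
    refine tsum_congr fun k => ?_
    simp only [profileCoeff, cosMultiplier, sineMultiplier]
    congr 1
    ring
  rw [this, hfc]

lemma coeff_freeEvolution_snd (t : ℝ) (W : State d) (k : Fin d → ℤ) :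
    coeff (freeEvolution t W).2 k = velocityCoeff t W k := by
  obtain ⟨f, hf, hfc⟩ := exists_hasSum_modeL2 (isHermitianSeq_velocityCoeff t W)
    ((summable_profileCoeff_bound _ W).of_nonneg_of_le (fun k => sq_nonneg _)
      (velocityCoeff_bound t W))
  have : (freeEvolution t W).2 = f := by
    rw [← hf.tsum_eq]
    refine tsum_congr fun k => ?_
    have e : eigenvalue k * sineMultiplier k t =
        Real.sqrt (eigenvalue k) * Real.sin (Real.sqrt (eigenvalue k) * t) := by
      rw [← sqrt_mul_sineMultiplier, ← mul_assoc, Real.mul_self_sqrt (eigenvalue_nonneg k)]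
    simp only [velocityCoeff, e, cosMultiplier]
    congr 1
    push_cast
    ring
  rw [this, hfc]

lemma State.coeff_ext {V W : State d} (h1 : ∀ k, coeff (toL2 V.1) k = coeff (toL2 W.1) k)
    (h2 : ∀ k, coeff V.2 k = coeff W.2 k) : V = W :=
  Prod.ext (H1.coeff_ext h1) (BilinearWave.coeff_ext h2)

lemma norm_freeEvolution_fst_sq_le (t : ℝ) (W : State d) :
    ‖(freeEvolution t W).1‖ ^ 2 ≤ 2 * ‖W.1‖ ^ 2 + 2 * (1 + t ^ 2) * ‖W.2‖ ^ 2 := by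
  refine hasSum_le (fun k => ?_) (H1.hasSum_norm_sq _)
    (((H1.hasSum_norm_sq W.1).mul_left 2).add ((hasSum_norm_coeff_sq W.2).mul_left _))
  rw [coeff_freeEvolution_fst]
  exact profileCoeff_bound t W k

lemma norm_freeEvolution_snd_sq_le (t : ℝ) (W : State d) :
    ‖(freeEvolution t W).2‖ ^ 2 ≤ 2 * ‖W.1‖ ^ 2 + 2 * ‖W.2‖ ^ 2 := by
  refine hasSum_le (fun k => ?_) (hasSum_norm_coeff_sq _)
    (((H1.hasSum_norm_sq W.1).mul_left 2).add ((hasSum_norm_coeff_sq W.2).mul_left _))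
  rw [coeff_freeEvolution_snd]
  exact velocityCoeff_bound t W k

lemma norm_freeEvolution_le (t : ℝ) (W : State d) :
    ‖freeEvolution t W‖ ≤ (2 + 2 * |t|) * ‖W‖ := by
  have h1 : ‖W.1‖ ^ 2 ≤ ‖W‖ ^ 2 := pow_le_pow_left₀ (norm_nonneg _) (norm_fst_le W) 2
  have h2 : ‖W.2‖ ^ 2 ≤ ‖W‖ ^ 2 := pow_le_pow_left₀ (norm_nonneg _) (norm_snd_le W) 2
  have ht : t ^ 2 = |t| ^ 2 := (sq_abs t).symm
  have h0 := abs_nonneg t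
  have hr : 0 ≤ (2 + 2 * |t|) * ‖W‖ := by positivity
  -- The norm of `State` is the maximum of the two component norms, so one bound for both suffices:
  -- 4 + 2t² ≤ (2 + 2|t|)².
  have hs : 2 * ‖W‖ ^ 2 + 2 * (1 + t ^ 2) * ‖W‖ ^ 2 ≤ ((2 + 2 * |t|) * ‖W‖) ^ 2 := by
    rw [ht, mul_pow]
    nlinarith [sq_nonneg ‖W‖, mul_nonneg h0 (sq_nonneg ‖W‖),
      mul_nonneg (sq_nonneg |t|) (sq_nonneg ‖W‖)]
  refine max_le ?_ ?_
  · refine (sq_le_sq₀ (norm_nonneg _) hr).mp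
      ((norm_freeEvolution_fst_sq_le t W).trans (le_trans ?_ hs))
    gcongr
  · refine (sq_le_sq₀ (norm_nonneg _) hr).mp
      ((norm_freeEvolution_snd_sq_le t W).trans (le_trans ?_ hs))
    have : 2 * ‖W.2‖ ^ 2 ≤ 2 * (1 + t ^ 2) * ‖W‖ ^ 2 := by
      nlinarith [mul_nonneg (sq_nonneg t) (sq_nonneg ‖W‖)]
    linarith

/-- The free evolution as a continuous linear map. -/
def freeCLM (t : ℝ) : State d →L[ℝ] State d :=
  LinearMap.mkContinuous
    { toFun := freeEvolution t
      map_add' := fun V W => by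
        refine State.coeff_ext (fun k => ?_) (fun k => ?_)
        · simp only [Prod.fst_add, map_add, coeff_add, coeff_freeEvolution_fst, profileCoeff,
            Prod.snd_add]
          ring
        · simp only [Prod.fst_add, map_add, coeff_add, coeff_freeEvolution_snd, velocityCoeff,
            Prod.snd_add]
          ring
      map_smul' := fun c W => by
        refine State.coeff_ext (fun k => ?_) (fun k => ?_)
        · simp only [Prod.smul_fst, map_smul, coeff_smul, coeff_freeEvolution_fst, profileCoeff,
            Prod.smul_snd, RingHom.id_apply]
          ring
        · simp only [Prod.smul_fst, map_smul, coeff_smul, coeff_freeEvolution_snd, velocityCoeff,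
            Prod.smul_snd, RingHom.id_apply]
          ring }
    (2 + 2 * |t|) (norm_freeEvolution_le t)

lemma freeCLM_apply (t : ℝ) (W : State d) : freeCLM t W = freeEvolution t W := rfl

lemma norm_freeCLM_le (t : ℝ) : ‖freeCLM (d := d) t‖ ≤ 2 + 2 * |t| :=
  LinearMap.mkContinuous_norm_le _ (by positivity) _

lemma freeCLM_zero (W : State d) : freeCLM 0 W = W := by
  refine State.coeff_ext (fun k => ?_) (fun k => ?_)
  · simp [freeCLM_apply, coeff_freeEvolution_fst, profileCoeff, sineMultiplier, cosMultiplier]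
  · simp [freeCLM_apply, coeff_freeEvolution_snd, velocityCoeff, sineMultiplier, cosMultiplier]

lemma freeCLM_add (s t : ℝ) (W : State d) : freeCLM (s + t) W = freeCLM s (freeCLM t W) := by
  refine State.coeff_ext (fun k => ?_) (fun k => ?_)
  · simp only [freeCLM_apply, coeff_freeEvolution_fst, profileCoeff, coeff_freeEvolution_snd,
      velocityCoeff, sineMultiplier_add, cosMultiplier_add]
    push_cast
    ring
  · simp only [freeCLM_apply, coeff_freeEvolution_fst, profileCoeff, coeff_freeEvolution_snd,
      velocityCoeff, sineMultiplier_add, cosMultiplier_add]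
    push_cast
    ring

lemma continuous_freeCLM_apply (W : State d) : Continuous fun t => freeCLM t W := by
  rw [continuous_iff_continuousAt]
  intro t₀
  -- The coefficient bound depends on t; near t₀ it is replaced by a single dominating sequence.
  have hev : ∀ᶠ t in nhds t₀, t ^ 2 ≤ (|t₀| + 1) ^ 2 := by
    filter_upwards [Metric.ball_mem_nhds t₀ one_pos] with t ht
    rw [sq_le_sq, abs_of_nonneg (by positivity : 0 ≤ |t₀| + 1)]
    rw [Metric.mem_ball, Real.dist_eq] at ht
    have := abs_add_le (t - t₀) t₀
    rw [sub_add_cancel] at this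
    linarith
  have h1 : ContinuousAt (fun t => (freeCLM t W).1) t₀ := by
    refine tendsto_of_dominated_coeff (fun f k => coeff (toL2 f) k)
      (fun f g k => by rw [map_sub, coeff_sub]) (fun k => 1 + eigenvalue k)
      (fun k => by linarith [eigenvalue_nonneg k]) H1.hasSum_norm_sq _ t₀ (fun k => ?_) _
      (summable_profileCoeff_bound (2 * (1 + (|t₀| + 1) ^ 2)) W) ?_
    · simp only [freeCLM_apply, coeff_freeEvolution_fst, profileCoeff]
      have := continuous_sineMultiplier k
      have := continuous_cosMultiplier k
      fun_prop
    · filter_upwards [hev] with t ht k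
      rw [freeCLM_apply, coeff_freeEvolution_fst]
      refine (profileCoeff_bound t W k).trans ?_
      gcongr
  have h2 : ContinuousAt (fun t => (freeCLM t W).2) t₀ := by
    refine tendsto_of_dominated_coeff coeff coeff_sub (fun _ => 1)
      (fun k => zero_le_one) (fun f => by simpa using hasSum_norm_coeff_sq f) _ t₀ (fun k => ?_) _
      (summable_profileCoeff_bound 2 W) ?_
    · simp only [freeCLM_apply, coeff_freeEvolution_snd, velocityCoeff]
      have := continuous_sineMultiplier k
      have := continuous_cosMultiplier k
      fun_prop
    · filter_upwards with t k
      rw [freeCLM_apply, coeff_freeEvolution_snd, one_mul]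
      exact velocityCoeff_bound t W k
  exact h1.prodMk h2

/-! ### Mild solutions of bounded perturbations of a strongly continuous group -/

/-- A locally bounded strongly continuous one-parameter group. -/
structure IsStronglyContinuousGroup {E : Type*} [NormedAddCommGroup E] [NormedSpace ℝ E]
    (U : ℝ → E →L[ℝ] E) : Prop where
  zero_apply : ∀ x, U 0 x = x
  add_apply : ∀ s t x, U (s + t) x = U s (U t x)
  continuous_apply : ∀ x, Continuous fun t => U t x
  bounded : ∀ T : ℝ, ∃ M, 0 ≤ M ∧ ∀ t, |t| ≤ T → ‖U t‖ ≤ M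

/-- Solutions of `W' = (𝒜 + K(t)) W` in the sense of Duhamel, `𝒜` being the generator of `U`. -/
def IsMildSolution {E : Type*} [NormedAddCommGroup E] [NormedSpace ℝ E] (U : ℝ → E →L[ℝ] E)
    (K : ℝ → E →L[ℝ] E) (T : ℝ) (x : E) (W : ℝ → E) : Prop :=
  ContinuousOn W (Icc 0 T) ∧ ∀ t ∈ Icc (0 : ℝ) T,
    IntervalIntegrable (fun s => U (t - s) (K s (W s))) volume 0 t ∧
    W t = U t x + ∫ s in (0 : ℝ)..t, U (t - s) (K s (W s))

/-- Grönwall's inequality in integral form. -/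
lemma gronwall_integral {g : ℝ → ℝ} {T a C : ℝ} (hT : 0 ≤ T) (hC : 0 ≤ C)
    (hg : ContinuousOn g (Icc 0 T)) (hg0 : ∀ t ∈ Icc 0 T, 0 ≤ g t)
    (h : ∀ t ∈ Icc 0 T, g t ≤ a + C * ∫ s in (0 : ℝ)..t, g s) :
    ∀ t ∈ Icc 0 T, g t ≤ a * Real.exp (C * t) := by
  -- The continuous extension of g makes its primitive differentiable everywhere. The right-hand
  -- side H then satisfies H' = C g ≤ C H on [0, T), to which the differential Grönwall inequality
  -- applies.
  set G : ℝ → ℝ := IccExtend hT ((Icc 0 T).domRestrict g) with hG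
  have hGc : Continuous G := (continuousOn_iff_continuous_domRestrict.mp hg).Icc_extend'
  have hGg : ∀ t ∈ Icc 0 T, G t = g t := fun t ht => IccExtend_of_mem hT _ ht
  have hI : ∀ t ∈ Icc 0 T, ∫ s in (0 : ℝ)..t, g s = ∫ s in (0 : ℝ)..t, G s := by
    intro t ht
    refine intervalIntegral.integral_congr fun s hs => (hGg s ?_).symm
    rw [uIcc_of_le ht.1] at hs
    exact ⟨hs.1, hs.2.trans ht.2⟩
  set H : ℝ → ℝ := fun t => a + C * ∫ s in (0 : ℝ)..t, G s with hH
  have hd : ∀ t, HasDerivAt H (C * G t) t := fun t =>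
    ((hGc.integral_hasStrictDerivAt 0 t).hasDerivAt.const_mul C).const_add a
  have hle : ∀ t ∈ Icc 0 T, g t ≤ H t := fun t ht => by
    simpa only [hH, ← hI t ht] using h t ht
  have ha : H 0 = a := by simp [hH]
  have ha0 : 0 ≤ a := ha ▸ (hg0 0 ⟨le_rfl, hT⟩).trans (hle 0 ⟨le_rfl, hT⟩)
  have key := norm_le_gronwallBound_of_norm_deriv_right_le (f := H) (f' := fun t => C * G t)
    (δ := a) (K := C) (ε := 0) (a := 0) (b := T)
    (fun t _ => (hd t).continuousAt.continuousWithinAt) (fun t _ => (hd t).hasDerivWithinAt)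
    (by rw [ha, Real.norm_of_nonneg ha0]) (fun t ht => by
      have ht' : t ∈ Icc 0 T := ⟨ht.1, ht.2.le⟩
      rw [hGg t ht', Real.norm_of_nonneg (mul_nonneg hC (hg0 t ht')), add_zero]
      exact mul_le_mul_of_nonneg_left ((hle t ht').trans (le_abs_self _)) hC)
  intro t ht
  have := key t ht
  rw [gronwallBound_ε0, sub_zero] at this
  exact (hle t ht).trans ((le_abs_self _).trans this)

section Abstract

variable {E : Type*} [NormedAddCommGroup E] [NormedSpace ℝ E] {U : ℝ → E →L[ℝ] E}

-- Strong continuity and local boundedness give joint continuity, by splitting U t y - U t₀ x₀ = U t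
-- (y - x₀) + (U t x₀ - U t₀ x₀).
open Filter Topology in
lemma IsStronglyContinuousGroup.continuous_uncurry (hU : IsStronglyContinuousGroup U) :
    Continuous fun p : ℝ × E => U p.1 p.2 := by
  rw [continuous_iff_continuousAt]
  rintro ⟨t₀, x₀⟩
  obtain ⟨M, hM0, hM⟩ := hU.bounded (|t₀| + 1)
  refine tendsto_iff_norm_sub_tendsto_zero.mpr ?_
  have h1 : Tendsto (fun p : ℝ × E => M * ‖p.2 - x₀‖ + ‖U p.1 x₀ - U t₀ x₀‖) (𝓝 (t₀, x₀))
      (𝓝 0) := by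
    have hc : Continuous fun p : ℝ × E => M * ‖p.2 - x₀‖ + ‖U p.1 x₀ - U t₀ x₀‖ :=
      (continuous_const.mul (continuous_snd.sub continuous_const).norm).add
        (((hU.continuous_apply x₀).comp continuous_fst).sub continuous_const).norm
    have := hc.tendsto (t₀, x₀)
    simpa using this
  refine squeeze_zero' (Eventually.of_forall fun _ => norm_nonneg _) ?_ h1
  have hev : ∀ᶠ p : ℝ × E in 𝓝 (t₀, x₀), |p.1| ≤ |t₀| + 1 := by
    have : ∀ᶠ t in 𝓝 t₀, |t| < |t₀| + 1 :=
      continuous_abs.continuousAt.eventually_lt continuousAt_const (by linarith)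
    exact (continuous_fst.continuousAt.eventually this).mono fun p hp => hp.le
  filter_upwards [hev] with p hp
  have e : U p.1 p.2 - U t₀ x₀ = U p.1 (p.2 - x₀) + (U p.1 x₀ - U t₀ x₀) := by
    rw [map_sub]; abel
  rw [e]
  refine (norm_add_le _ _).trans ?_
  gcongr
  exact ((U p.1).le_opNorm _).trans (mul_le_mul_of_nonneg_right (hM _ hp) (norm_nonneg _))

/-- Lipschitz dependence of mild solutions on the initial value. -/
lemma IsMildSolution.norm_sub_le {K : ℝ → E →L[ℝ] E} {T M κ : ℝ} {x y : E}
    {V W : ℝ → E} (hT : 0 ≤ T) (hM0 : 0 ≤ M) (hM : ∀ t, |t| ≤ T → ‖U t‖ ≤ M) (hκ0 : 0 ≤ κ)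
    (hκ : ∀ s, ‖K s‖ ≤ κ) (hV : IsMildSolution U K T x V) (hW : IsMildSolution U K T y W) :
    ∀ t ∈ Icc 0 T, ‖V t - W t‖ ≤ M * ‖x - y‖ * Real.exp (M * κ * t) := by
  have hc : ContinuousOn (fun t => ‖V t - W t‖) (Icc 0 T) := (hV.1.sub hW.1).norm
  refine gronwall_integral hT (mul_nonneg hM0 hκ0) hc (fun _ _ => norm_nonneg _) fun t ht => ?_
  obtain ⟨hVi, hVt⟩ := hV.2 t ht
  obtain ⟨hWi, hWt⟩ := hW.2 t ht
  have e : V t - W t = U t (x - y) + ∫ s in (0 : ℝ)..t, U (t - s) (K s (V s - W s)) := by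
    simp only [map_sub]
    rw [intervalIntegral.integral_sub hVi hWi]
    nth_rewrite 1 [hVt, hWt]
    abel
  have hsub : uIcc 0 t ⊆ Icc 0 T := by
    rw [uIcc_of_le ht.1]
    exact Icc_subset_Icc le_rfl ht.2
  rw [e]
  refine (norm_add_le _ _).trans (add_le_add ?_ ?_)
  · refine ((U t).le_opNorm _).trans (mul_le_mul_of_nonneg_right (hM t ?_) (norm_nonneg _))
    rw [abs_of_nonneg ht.1]
    exact ht.2
  · rw [← intervalIntegral.integral_const_mul]
    refine intervalIntegral.norm_integral_le_of_norm_le ht.1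
      (Filter.Eventually.of_forall fun s hs => ?_)
      ((hc.mono hsub).const_smul (M * κ)).intervalIntegrable
    have h1 : ‖U (t - s)‖ ≤ M := by
      refine hM _ ?_
      rw [abs_of_nonneg (by linarith [hs.2])]
      linarith [hs.1, ht.2]
    calc ‖U (t - s) (K s (V s - W s))‖ ≤ M * ‖K s (V s - W s)‖ :=
          ((U (t - s)).le_opNorm _).trans (mul_le_mul_of_nonneg_right h1 (norm_nonneg _))
      _ ≤ M * (κ * ‖V s - W s‖) := by
          gcongr
          exact ((K s).le_opNorm _).trans (mul_le_mul_of_nonneg_right (hκ s) (norm_nonneg _))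
      _ = M * κ * ‖V s - W s‖ := by ring

lemma IsMildSolution.eqOn (hU : IsStronglyContinuousGroup U) {K : ℝ → E →L[ℝ] E} {T κ : ℝ} {x : E}
    {V W : ℝ → E} (hT : 0 ≤ T) (hκ : ∀ s, ‖K s‖ ≤ κ) (hV : IsMildSolution U K T x V)
    (hW : IsMildSolution U K T x W) : EqOn V W (Icc 0 T) := by
  obtain ⟨M, hM0, hM⟩ := hU.bounded T
  intro t ht
  have := hV.norm_sub_le hT hM0 hM ((norm_nonneg _).trans (hκ 0)) hκ hW t ht
  simpa [sub_eq_zero] using this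

variable [CompleteSpace E]

/-- Concatenation of mild solutions. -/
lemma IsMildSolution.concat (hU : IsStronglyContinuousGroup U) {K₁ K₂ : ℝ → E →L[ℝ] E}
    {τ T : ℝ} (hτ : 0 ≤ τ) (hT : 0 ≤ T) {x : E} {W₁ W₂ : ℝ → E} (h₁ : IsMildSolution U K₁ τ x W₁)
    (h₂ : IsMildSolution U K₂ T (W₁ τ) W₂) :
    IsMildSolution U (fun s => if s < τ then K₁ s else K₂ (s - τ)) (τ + T) x
      (fun s => if s < τ then W₁ s else W₂ (s - τ)) := by
  set K : ℝ → E →L[ℝ] E := fun s => if s < τ then K₁ s else K₂ (s - τ) with hK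
  set W : ℝ → E := fun s => if s < τ then W₁ s else W₂ (s - τ) with hW
  have h0 : W₂ 0 = W₁ τ := by
    have := (h₂.2 0 ⟨le_rfl, hT⟩).2
    simpa [hU.zero_apply] using this
  have hW1 : EqOn W W₁ (Icc 0 τ) := by
    intro s hs
    by_cases h : s < τ
    · simp [hW, h]
    · have : s = τ := le_antisymm hs.2 (not_lt.mp h)
      simp [hW, this, h0]
  have hW2 : EqOn W (fun s => W₂ (s - τ)) (Icc τ (τ + T)) := by
    intro s hs
    simp [hW, not_lt.mpr hs.1]
  refine ⟨?_, fun t ht => ?_⟩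
  · have hu : Icc 0 (τ + T) = Icc 0 τ ∪ Icc τ (τ + T) :=
      (Icc_union_Icc_eq_Icc hτ (by linarith)).symm
    rw [hu]
    refine ContinuousOn.union_of_isClosed (h₁.1.congr hW1) (ContinuousOn.congr ?_ hW2)
      isClosed_Icc isClosed_Icc
    refine h₂.1.comp (by fun_prop) fun s hs => ⟨by linarith [hs.1], by linarith [hs.2]⟩
  -- Integrands are compared on open intervals only, since at s = τ the two perturbations need not
  -- agree.
  · have hA : ∀ r t', r ≤ τ → EqOn (fun s => U (t' - s) (K₁ s (W₁ s)))
        (fun s => U (t' - s) (K s (W s))) (Ioo 0 r) := by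
      intro r t' hr s hs
      have : s < τ := hs.2.trans_le hr
      simp [hK, hW, this]
    rcases le_total t τ with htτ | htτ
    · obtain ⟨hi, he⟩ := h₁.2 t ⟨ht.1, htτ⟩
      have hA' := hA t t htτ
      refine ⟨hi.congr_uIoo (by rwa [uIoo_of_le ht.1]), ?_⟩
      rw [hW1 ⟨ht.1, htτ⟩, he, intervalIntegral.integral_congr_Ioo_of_le ht.1 hA']
    · obtain ⟨hi₁, he₁⟩ := h₁.2 τ ⟨hτ, le_rfl⟩
      obtain ⟨hi₂, he₂⟩ := h₂.2 (t - τ) ⟨by linarith, by linarith [ht.2]⟩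
      -- For t ≥ τ, the group law carries the Duhamel formula at τ forward to t, giving the part of
      -- the integral over [0, τ].
      have e1 : ∀ s, U (t - τ) (U (τ - s) (K₁ s (W₁ s))) = U (t - s) (K₁ s (W₁ s)) := fun s => by
        rw [← hU.add_apply]
        congr 2
        ring
      have hi₁' : IntervalIntegrable (fun s => U (t - s) (K₁ s (W₁ s))) volume 0 τ := by
        have : IntervalIntegrable (fun s => U (t - τ) (U (τ - s) (K₁ s (W₁ s)))) volume 0 τ :=
          ⟨(U (t - τ)).integrable_comp hi₁.1, (U (t - τ)).integrable_comp hi₁.2⟩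
        simpa only [e1] using this
      have hi₁'' : IntervalIntegrable (fun s => U (t - s) (K s (W s))) volume 0 τ :=
        hi₁'.congr_uIoo (by rw [uIoo_of_le hτ]; exact hA τ t le_rfl)
      have hB : EqOn (fun s => U (t - τ - (s - τ)) (K₂ (s - τ) (W₂ (s - τ))))
          (fun s => U (t - s) (K s (W s))) (Ioo τ t) := by
        intro s hs
        have h1 : ¬ s < τ := not_lt.mpr hs.1.le
        have h2 : t - τ - (s - τ) = t - s := by ring
        simp [hK, hW, h1, h2]
      have hi₂' := hi₂.comp_sub_right τ
      rw [zero_add, sub_add_cancel] at hi₂'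
      have hi₂'' : IntervalIntegrable (fun s => U (t - s) (K s (W s))) volume τ t :=
        hi₂'.congr_uIoo (by rw [uIoo_of_le htτ]; exact hB)
      refine ⟨hi₁''.trans hi₂'', ?_⟩
      rw [hW2 ⟨htτ, ht.2⟩]
      simp only
      rw [he₂, ← intervalIntegral.integral_add_adjacent_intervals hi₁'' hi₂'',
        ← intervalIntegral.integral_congr_Ioo_of_le hτ (hA τ t le_rfl),
        ← intervalIntegral.integral_congr_Ioo_of_le htτ hB,
        intervalIntegral.integral_comp_sub_right
          (fun s => U (t - τ - s) (K₂ s (W₂ s))) τ, sub_self, he₁, map_add, ← hU.add_apply,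
        sub_add_cancel, ← ContinuousLinearMap.intervalIntegral_comp_comm _ hi₁, add_assoc]
      simp only [e1]

lemma integral_exp_mul_le {lam t : ℝ} (hl : 0 < lam) :
    ∫ s in (0 : ℝ)..t, Real.exp (lam * s) ≤ lam⁻¹ * Real.exp (lam * t) := by
  rw [intervalIntegral.integral_comp_mul_left (fun s => Real.exp s) hl.ne', integral_exp,
    smul_eq_mul, mul_zero, Real.exp_zero]
  exact mul_le_mul_of_nonneg_left (by linarith) (inv_nonneg.mpr hl.le)

/-- Existence of mild solutions for a constant perturbation, by the contraction principle in an
exponentially weighted supremum norm. -/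
lemma exists_isMildSolution_const (hU : IsStronglyContinuousGroup U) (K : E →L[ℝ] E) {T : ℝ}
    (hT : 0 ≤ T) (x : E) : ∃ W, IsMildSolution U (fun _ => K) T x W := by
  obtain ⟨M, hM0, hM⟩ := hU.bounded T
  -- The summand 1 keeps the weight exponent `lam = 2 * C` positive; the contraction constant will
  -- be C / lam = 1/2.
  set C : ℝ := M * ‖K‖ + 1 with hCdef
  have hC : 0 < C := by positivity
  set lam : ℝ := 2 * C with hlam
  have hl : 0 < lam := by positivity
  have hUc := hU.continuous_uncurry
  -- The unknown f stands for e^(-lam s) W(s), so that the plain supremum norm of f is the weighted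
  -- norm of W; `ext` recovers W.
  let ext : C(Icc (0 : ℝ) T, E) → ℝ → E := fun f s => Real.exp (lam * s) • IccExtend hT f s
  have hext : ∀ f, Continuous (ext f) := fun f => by
    have : Continuous (IccExtend hT f) := f.continuous.Icc_extend'
    exact (Real.continuous_exp.comp (continuous_const.mul continuous_id)).smul this
  have hint : ∀ (f : C(Icc (0 : ℝ) T, E)),
      Continuous (Function.uncurry fun t s : ℝ => U (t - s) (K (ext f s))) := fun f => by
    have h1 : Continuous fun p : ℝ × ℝ => (p.1 - p.2, K (ext f p.2)) := by
      have := hext f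
      fun_prop
    exact hUc.comp h1
  let duh : C(Icc (0 : ℝ) T, E) → ℝ → E := fun f t =>
    U t x + ∫ s in (0 : ℝ)..t, U (t - s) (K (ext f s))
  have hduh : ∀ f, Continuous (duh f) := fun f => (hU.continuous_apply x).add
    (intervalIntegral.continuous_parametric_intervalIntegral_of_continuous (hint f) continuous_id)
  let Φ : C(Icc (0 : ℝ) T, E) → C(Icc (0 : ℝ) T, E) := fun f =>
    ⟨fun t => Real.exp (-(lam * t)) • duh f t, by
      have := hduh f
      fun_prop⟩
  have hcontr : ContractingWith (1 / 2) Φ := by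
    refine ⟨by norm_num, LipschitzWith.of_dist_le_mul fun f g => ?_⟩
    rw [ContinuousMap.dist_le (by positivity)]
    intro t
    have ht0 : (0 : ℝ) ≤ t := t.2.1
    have hi : ∀ f : C(Icc (0 : ℝ) T, E),
        IntervalIntegrable (fun s => U (t - s) (K (ext f s))) volume 0 t := fun f =>
      ((hint f).comp (by fun_prop : Continuous fun s : ℝ => ((t : ℝ), s))).intervalIntegrable _ _
    have e : Φ f t - Φ g t = Real.exp (-(lam * t)) •
        ∫ s in (0 : ℝ)..t, U (t - s) (K (ext f s - ext g s)) := by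
      change Real.exp (-(lam * t)) • duh f t - Real.exp (-(lam * t)) • duh g t = _
      rw [← smul_sub]
      congr 1
      simp only [map_sub, duh]
      rw [intervalIntegral.integral_sub (hi f) (hi g)]
      abel
    have hbound : ‖∫ s in (0 : ℝ)..t, U (t - s) (K (ext f s - ext g s))‖ ≤
        ∫ s in (0 : ℝ)..t, C * dist f g * Real.exp (lam * s) := by
      refine intervalIntegral.norm_integral_le_of_norm_le ht0
        (Filter.Eventually.of_forall fun s hs => ?_) (by
          apply Continuous.intervalIntegrable
          fun_prop)
      have h1 : ‖U (t - s)‖ ≤ M := by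
        refine hM _ ?_
        rw [abs_of_nonneg (by linarith [hs.2])]
        linarith [hs.1, t.2.2]
      have h2 : ‖ext f s - ext g s‖ ≤ Real.exp (lam * s) * dist f g := by
        simp only [ext]
        rw [← smul_sub, norm_smul, Real.norm_of_nonneg (Real.exp_pos _).le]
        gcongr
        rw [← dist_eq_norm]
        exact ContinuousMap.dist_apply_le_dist _
      calc ‖U (t - s) (K (ext f s - ext g s))‖ ≤ M * ‖K (ext f s - ext g s)‖ :=
            ((U (t - s)).le_opNorm _).trans (mul_le_mul_of_nonneg_right h1 (norm_nonneg _))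
        _ ≤ M * (‖K‖ * (Real.exp (lam * s) * dist f g)) := by
            gcongr
            exact (K.le_opNorm _).trans (mul_le_mul_of_nonneg_left h2 (norm_nonneg _))
        _ = M * ‖K‖ * (Real.exp (lam * s) * dist f g) := by ring
        _ ≤ C * (Real.exp (lam * s) * dist f g) := by
            gcongr
            simp [hCdef]
        _ = C * dist f g * Real.exp (lam * s) := by ring
    rw [dist_eq_norm, e, norm_smul, Real.norm_of_nonneg (Real.exp_pos _).le]
    rw [intervalIntegral.integral_const_mul] at hbound
    calc Real.exp (-(lam * t)) * ‖∫ s in (0 : ℝ)..t, U (t - s) (K (ext f s - ext g s))‖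
        ≤ Real.exp (-(lam * t)) * (C * dist f g * (lam⁻¹ * Real.exp (lam * t))) := by
          gcongr
          refine hbound.trans ?_
          gcongr
          exact integral_exp_mul_le hl
      _ = (C * lam⁻¹) * dist f g * (Real.exp (-(lam * t)) * Real.exp (lam * t)) := by ring
      _ = (C * lam⁻¹) * dist f g := by rw [← Real.exp_add, neg_add_cancel, Real.exp_zero, mul_one]
      _ = ((1 / 2 : NNReal) : ℝ) * dist f g := by
          congr 1
          rw [hlam]
          push_cast
          field_simp
  obtain ⟨f, hf, -⟩ := hcontr.exists_fixedPoint 0 (edist_ne_top _ _)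
  refine ⟨ext f, (hext f).continuousOn, fun t ht => ⟨?_, ?_⟩⟩
  · exact ((hint f).comp (by fun_prop : Continuous fun s : ℝ => ((t : ℝ), s))).intervalIntegrable _ _
  · have h1 : f ⟨t, ht⟩ = Real.exp (-(lam * t)) • duh f t :=
      (congrArg (fun g : C(Icc (0 : ℝ) T, E) => g ⟨t, ht⟩) hf).symm
    change Real.exp (lam * t) • IccExtend hT f t = duh f t
    rw [IccExtend_of_mem hT f ht, h1, smul_smul, ← Real.exp_add, add_neg_cancel, Real.exp_zero,
      one_smul]

end Abstract

/-! ### The flow of piecewise constant controls -/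

section Flow

variable {E : Type*} [NormedAddCommGroup E] [NormedSpace ℝ E] {U : ℝ → E →L[ℝ] E}

/-- The value at time `T` of the mild solution for the constant perturbation `K`. -/
def mildFlow (U : ℝ → E →L[ℝ] E) (K : E →L[ℝ] E) (T : ℝ) (x : E) : E :=
  Classical.epsilon (fun W => IsMildSolution U (fun _ => K) T x W) T

lemma isMildSolution_epsilon [CompleteSpace E] (hU : IsStronglyContinuousGroup U) (K : E →L[ℝ] E)
    {T : ℝ} (hT : 0 ≤ T) (x : E) : IsMildSolution U (fun _ => K) T x
      (Classical.epsilon fun W => IsMildSolution U (fun _ => K) T x W) :=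
  Classical.epsilon_spec (exists_isMildSolution_const hU K hT x)

lemma mildFlow_zero [CompleteSpace E] (hU : IsStronglyContinuousGroup U) {T : ℝ} (hT : 0 ≤ T)
    (x : E) : mildFlow U 0 T x = U T x := by
  refine ((isMildSolution_epsilon hU 0 hT x).2 T ⟨hT, le_rfl⟩).2.trans ?_
  simp

lemma exists_norm_mildFlow_sub_le [CompleteSpace E] (hU : IsStronglyContinuousGroup U)
    (K : E →L[ℝ] E) {T : ℝ} (hT : 0 ≤ T) :
    ∃ C, 0 ≤ C ∧ ∀ x y, ‖mildFlow U K T x - mildFlow U K T y‖ ≤ C * ‖x - y‖ := by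
  obtain ⟨M, hM0, hM⟩ := hU.bounded T
  refine ⟨M * Real.exp (M * ‖K‖ * T), by positivity, fun x y => ?_⟩
  have := (isMildSolution_epsilon hU K hT x).norm_sub_le hT hM0 hM (norm_nonneg K)
    (fun _ => le_rfl) (isMildSolution_epsilon hU K hT y) T ⟨hT, le_rfl⟩
  refine this.trans (le_of_eq ?_)
  ring

open Filter Topology in
/-- A nilpotent perturbation of size `δ⁻¹` acting for the time `δ` becomes an impulse. -/
lemma tendsto_mildFlow_impulse [CompleteSpace E] (hU : IsStronglyContinuousGroup U)
    (K : E →L[ℝ] E) (hK : ∀ x, K (K x) = 0) (x : E) :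
    Tendsto (fun δ : ℝ => mildFlow U (δ⁻¹ • K) δ x) (𝓝[>] 0) (𝓝 (x + K x)) := by
  obtain ⟨M, hM0, hM⟩ := hU.bounded 1
  rw [Metric.tendsto_nhds]
  intro ε hε
  set B := Real.exp (M * ‖K‖) with hB
  have hBpos : 0 < B := Real.exp_pos _
  -- The final error will be 2 η B = ε / 2.
  set η := ε / (4 * B) with hη
  have hηpos : 0 < η := by positivity
  have hclose : ∀ y : E, ∃ ρ > 0, ∀ t, |t| < ρ → ‖U t y - y‖ < η := by
    intro y
    obtain ⟨ρ, hρ, h⟩ := Metric.continuousAt_iff.mp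
      ((hU.continuous_apply y).continuousAt (x := (0 : ℝ))) η hηpos
    refine ⟨ρ, hρ, fun t ht => ?_⟩
    have := h (x := t) (by simpa using ht)
    rwa [hU.zero_apply, dist_eq_norm] at this
  obtain ⟨ρ₁, hρ₁, h₁⟩ := hclose x
  obtain ⟨ρ₂, hρ₂, h₂⟩ := hclose (K x)
  have hmem : Ioo (0 : ℝ) (min 1 (min ρ₁ ρ₂)) ∈ 𝓝[>] (0 : ℝ) :=
    Ioo_mem_nhdsGT (by positivity)
  filter_upwards [hmem] with δ hδ
  have hδ0 : 0 < δ := hδ.1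
  have hδ1 : δ ≤ 1 := hδ.2.le.trans (min_le_left _ _)
  have hδρ₁ : δ < ρ₁ := hδ.2.trans_le ((min_le_right _ _).trans (min_le_left _ _))
  have hδρ₂ : δ < ρ₂ := hδ.2.trans_le ((min_le_right _ _).trans (min_le_right _ _))
  have hs := isMildSolution_epsilon hU (δ⁻¹ • K) hδ0.le x
  set W := Classical.epsilon fun W => IsMildSolution U (fun _ => δ⁻¹ • K) δ x W with hW
  have hflow : mildFlow U (δ⁻¹ • K) δ x = W δ := rfl
  -- The solution when the group is replaced by the identity: K² = 0 gives K (Y s) = K x, so Y is a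
  -- linear ramp. The group moves x and K x by less than η during [0, δ], which keeps W close to Y.
  set Y : ℝ → E := fun t => x + (t * δ⁻¹) • K x with hY
  have hYc : Continuous Y := by fun_prop
  have hKY : ∀ s, K (Y s) = K x := fun s => by simp [hY, hK]
  have hc : ContinuousOn (fun t => ‖W t - Y t‖) (Icc 0 δ) := (hs.1.sub hYc.continuousOn).norm
  have key : ∀ t ∈ Icc 0 δ, ‖W t - Y t‖ ≤ 2 * η * Real.exp (M * ‖K‖ * δ⁻¹ * t) := by
    refine gronwall_integral hδ0.le (by positivity) hc (fun _ _ => norm_nonneg _) fun t ht => ?_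
    obtain ⟨hi, he⟩ := hs.2 t ht
    have hUc : Continuous fun s => U (t - s) (K x) :=
      (hU.continuous_apply (K x)).comp (continuous_const.sub continuous_id)
    have hi2 : IntervalIntegrable (fun s => U (t - s) ((δ⁻¹ • K) (Y s))) volume 0 t := by
      apply Continuous.intervalIntegrable
      simp only [_root_.smul_apply, hKY, map_smul]
      exact hUc.const_smul _
    have hYi : ∫ s in (0 : ℝ)..t, U (t - s) ((δ⁻¹ • K) (Y s)) =
        (∫ s in (0 : ℝ)..t, δ⁻¹ • (U (t - s) (K x) - K x)) + (t * δ⁻¹) • K x := by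
      simp only [_root_.smul_apply, hKY, map_smul]
      have : (t * δ⁻¹) • K x = ∫ s in (0 : ℝ)..t, δ⁻¹ • K x := by
        rw [intervalIntegral.integral_const, sub_zero, smul_smul]
      rw [this, ← intervalIntegral.integral_add]
      · simp only [← smul_add, sub_add_cancel]
      · exact ((hUc.sub continuous_const).const_smul _).intervalIntegrable _ _
      · exact continuous_const.intervalIntegrable _ _
    have e : W t - Y t = (U t x - x) + (∫ s in (0 : ℝ)..t, δ⁻¹ • (U (t - s) (K x) - K x)) +
        ∫ s in (0 : ℝ)..t, U (t - s) ((δ⁻¹ • K) (W s - Y s)) := by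
      simp only [map_sub]
      rw [intervalIntegral.integral_sub hi hi2, hYi]
      nth_rewrite 1 [he]
      simp only [hY]
      abel
    have hsub : uIcc 0 t ⊆ Icc 0 δ := by
      rw [uIcc_of_le ht.1]
      exact Icc_subset_Icc le_rfl ht.2
    have b1 : ‖U t x - x‖ ≤ η :=
      (h₁ t (by rw [abs_of_nonneg ht.1]; exact ht.2.trans_lt hδρ₁)).le
    have b2 : ‖∫ s in (0 : ℝ)..t, δ⁻¹ • (U (t - s) (K x) - K x)‖ ≤ η := by
      have := intervalIntegral.norm_integral_le_of_norm_le_const (a := 0) (b := t)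
        (f := fun s => δ⁻¹ • (U (t - s) (K x) - K x)) (C := δ⁻¹ * η) fun s hs => by
          rw [uIoc_of_le ht.1] at hs
          rw [norm_smul, Real.norm_of_nonneg (inv_nonneg.mpr hδ0.le)]
          gcongr
          refine (h₂ (t - s) ?_).le
          rw [abs_of_nonneg (by linarith [hs.2])]
          linarith [hs.1, ht.2]
      refine this.trans ?_
      rw [sub_zero, abs_of_nonneg ht.1]
      calc δ⁻¹ * η * t ≤ δ⁻¹ * η * δ := by gcongr; exact ht.2
        _ = η := by field_simp
    have b3 : ‖∫ s in (0 : ℝ)..t, U (t - s) ((δ⁻¹ • K) (W s - Y s))‖ ≤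
        M * ‖K‖ * δ⁻¹ * ∫ s in (0 : ℝ)..t, ‖W s - Y s‖ := by
      rw [← intervalIntegral.integral_const_mul]
      refine intervalIntegral.norm_integral_le_of_norm_le ht.1
        (Filter.Eventually.of_forall fun s hs => ?_)
        ((hc.mono hsub).const_smul (M * ‖K‖ * δ⁻¹)).intervalIntegrable
      have h1 : ‖U (t - s)‖ ≤ M := by
        refine hM _ ?_
        rw [abs_of_nonneg (by linarith [hs.2])]
        linarith [hs.1, ht.2]
      calc ‖U (t - s) ((δ⁻¹ • K) (W s - Y s))‖ ≤ M * ‖(δ⁻¹ • K) (W s - Y s)‖ :=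
            ((U (t - s)).le_opNorm _).trans (mul_le_mul_of_nonneg_right h1 (norm_nonneg _))
        _ ≤ M * (δ⁻¹ * (‖K‖ * ‖W s - Y s‖)) := by
            gcongr
            rw [_root_.smul_apply, norm_smul,
              Real.norm_of_nonneg (inv_nonneg.mpr hδ0.le)]
            gcongr
            exact K.le_opNorm _
        _ = M * ‖K‖ * δ⁻¹ * ‖W s - Y s‖ := by ring
    rw [e]
    refine (norm_add_le _ _).trans (add_le_add ((norm_add_le _ _).trans ?_) b3)
    linarith
  -- At t = δ the Grönwall exponent M ‖K‖ δ⁻¹ δ no longer depends on δ.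
  have hfin := key δ ⟨hδ0.le, le_rfl⟩
  rw [mul_assoc (M * ‖K‖), inv_mul_cancel₀ hδ0.ne', mul_one] at hfin
  have hYδ : Y δ = x + K x := by simp [hY, mul_inv_cancel₀ hδ0.ne']
  rw [hflow, dist_eq_norm, ← hYδ]
  refine hfin.trans_lt ?_
  rw [← hB, hη]
  have : 2 * (ε / (4 * B)) * B = ε / 2 := by field_simp; norm_num
  rw [this]
  linarith

variable {X : Type*}

/-- The final state after consecutively applying the controls `c` for the times `τ` of a list of
pairs `(τ, c)`. -/
def listFlow (U : ℝ → E →L[ℝ] E) (K : X → E →L[ℝ] E) : List (ℝ × X) → E → E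
  | [], x => x
  | e :: l, x => listFlow U K l (mildFlow U (K e.2) e.1 x)

/-- The control as a function of time. -/
def listControl (c₀ : X) : List (ℝ × X) → ℝ → X
  | [], _ => c₀
  | e :: l, s => if s < e.1 then e.2 else listControl c₀ l (s - e.1)

/-- The total duration. -/
def listTime (l : List (ℝ × X)) : ℝ := (l.map Prod.fst).sum

lemma listTime_cons (e : ℝ × X) (l : List (ℝ × X)) : listTime (e :: l) = e.1 + listTime l := by
  simp [listTime]

lemma listTime_append (l l' : List (ℝ × X)) : listTime (l ++ l') = listTime l + listTime l' := by
  simp [listTime]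

lemma listTime_nonneg {l : List (ℝ × X)} (hl : ∀ e ∈ l, 0 < e.1) : 0 ≤ listTime l := by
  refine List.sum_nonneg fun t ht => ?_
  obtain ⟨e, he, rfl⟩ := List.mem_map.mp ht
  exact (hl e he).le

lemma listFlow_append (K : X → E →L[ℝ] E) (l l' : List (ℝ × X)) (x : E) :
    listFlow U K (l ++ l') x = listFlow U K l' (listFlow U K l x) := by
  induction l generalizing x with
  | nil => rfl
  | cons e l ih => exact ih _

lemma exists_norm_listFlow_sub_le [CompleteSpace E] (hU : IsStronglyContinuousGroup U)
    (K : X → E →L[ℝ] E) (l : List (ℝ × X)) (hl : ∀ e ∈ l, 0 < e.1) :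
    ∃ C, 0 ≤ C ∧ ∀ x y, ‖listFlow U K l x - listFlow U K l y‖ ≤ C * ‖x - y‖ := by
  induction l with
  | nil => exact ⟨1, zero_le_one, fun x y => by simp [listFlow]⟩
  | cons e l ih =>
    obtain ⟨C, hC, h⟩ := ih fun e' he' => hl e' (List.mem_cons_of_mem _ he')
    obtain ⟨D, hD, h'⟩ := exists_norm_mildFlow_sub_le hU (K e.2) (hl e List.mem_cons_self).le
    refine ⟨C * D, mul_nonneg hC hD, fun x y => (h _ _).trans ?_⟩
    rw [mul_assoc]
    exact mul_le_mul_of_nonneg_left (h' x y) hC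

lemma exists_isMildSolution_listControl [CompleteSpace E] (hU : IsStronglyContinuousGroup U)
    (K : X → E →L[ℝ] E) (c₀ : X) (l : List (ℝ × X)) (hl : ∀ e ∈ l, 0 < e.1) (x : E) :
    ∃ W, IsMildSolution U (fun s => K (listControl c₀ l s)) (listTime l) x W ∧
      W (listTime l) = listFlow U K l x := by
  induction l generalizing x with
  | nil =>
    refine ⟨fun _ => x, ⟨continuousOn_const, fun t ht => ?_⟩, rfl⟩
    have : t = 0 := le_antisymm (by simpa [listTime] using ht.2) ht.1
    subst this
    simp [hU.zero_apply]
  | cons e l ih =>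
    have hl' : ∀ e' ∈ l, 0 < e'.1 := fun e' he' => hl e' (List.mem_cons_of_mem _ he')
    have he := hl e List.mem_cons_self
    have h₁ := isMildSolution_epsilon hU (K e.2) he.le x
    obtain ⟨W, hW, hWe⟩ := ih hl' (mildFlow U (K e.2) e.1 x)
    have h := h₁.concat hU he.le (listTime_nonneg hl') hW
    have hK : (fun s => K (listControl c₀ (e :: l) s)) =
        fun s => if s < e.1 then K e.2 else K (listControl c₀ l (s - e.1)) := by
      funext s
      simp only [listControl]
      split_ifs <;> rfl
    refine ⟨_, by rw [hK, listTime_cons]; exact h, ?_⟩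
    have hn : ¬ e.1 + listTime l < e.1 := by linarith [listTime_nonneg hl']
    rw [listTime_cons]
    simp only [hn, if_false, add_sub_cancel_left, hWe]
    rfl

lemma exists_norm_listControl_le (K : X → E →L[ℝ] E) (c₀ : X) (l : List (ℝ × X)) :
    ∃ κ, ∀ s, ‖K (listControl c₀ l s)‖ ≤ κ := by
  induction l with
  | nil => exact ⟨‖K c₀‖, fun s => le_rfl⟩
  | cons e l ih =>
    obtain ⟨κ, h⟩ := ih
    refine ⟨max ‖K e.2‖ κ, fun s => ?_⟩
    simp only [listControl]
    split_ifs
    · exact le_max_left _ _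
    · exact (h _).trans (le_max_right _ _)

lemma isPiecewiseConstant_listControl (c₀ : X) (l : List (ℝ × X)) (hl : ∀ e ∈ l, 0 < e.1) :
    IsPiecewiseConstant (listTime l) (listControl c₀ l) := by
  induction l with
  | nil =>
    refine ⟨0, fun _ => 0, fun i j h => absurd h (by omega), rfl, by simp [listTime], fun i => i.elim0⟩
  | cons e l ih =>
    have he := hl e List.mem_cons_self
    obtain ⟨N, t, ht, ht0, htN, hc⟩ := ih fun e' he' => hl e' (List.mem_cons_of_mem _ he')
    -- The subdivision for the tail is shifted by the first duration, and 0 is prepended.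
    refine ⟨N + 1, Fin.cons 0 fun i => e.1 + t i, ?_, rfl, ?_, ?_⟩
    · rw [Fin.strictMono_iff_lt_succ]
      intro i
      refine Fin.cases ?_ (fun j => ?_) i
      · simpa [ht0] using he
      · have := ht (Fin.castSucc_lt_succ (i := j))
        simpa [← Fin.succ_castSucc] using this
    · rw [← Fin.succ_last, Fin.cons_succ, htN, listTime_cons]
    · intro i
      refine Fin.cases ?_ (fun j => ?_) i
      · refine ⟨e.2, fun s hs => ?_⟩
        have : s < e.1 := by simpa [ht0] using hs.2
        simp [listControl, this]
      · obtain ⟨c, hc⟩ := hc j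
        refine ⟨c, fun s hs => ?_⟩
        rw [← Fin.succ_castSucc, Fin.cons_succ, Fin.cons_succ] at hs
        have h0 : 0 ≤ t j.castSucc := ht0 ▸ ht.monotone (Fin.zero_le _)
        have hn : ¬ s < e.1 := by linarith [hs.1]
        simp only [listControl, hn, if_false]
        exact hc _ ⟨by linarith [hs.1], by linarith [hs.2]⟩

end Flow

/-! ### Multiplication operators -/

lemma coeFn_mulL2 (V : C(Torus d, ℝ)) (f : L2 d) : ∀ᵐ x, mulL2 V f x = V x * f x :=
  MemLp.coeFn_toLp _

lemma mulL2_add (V : C(Torus d, ℝ)) (f g : L2 d) : mulL2 V (f + g) = mulL2 V f + mulL2 V g := by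
  refine Lp.ext ?_
  filter_upwards [coeFn_mulL2 V (f + g), coeFn_mulL2 V f, coeFn_mulL2 V g, Lp.coeFn_add f g,
    Lp.coeFn_add (mulL2 V f) (mulL2 V g)] with x h1 h2 h3 h4 h5
  rw [h1, h5, Pi.add_apply, h2, h3, h4, Pi.add_apply, mul_add]

lemma mulL2_smul (V : C(Torus d, ℝ)) (c : ℝ) (f : L2 d) : mulL2 V (c • f) = c • mulL2 V f := by
  refine Lp.ext ?_
  filter_upwards [coeFn_mulL2 V (c • f), coeFn_mulL2 V f, Lp.coeFn_smul c f,
    Lp.coeFn_smul c (mulL2 V f)] with x h1 h2 h3 h4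
  rw [h1, h4, Pi.smul_apply, h2, h3, Pi.smul_apply, smul_eq_mul, smul_eq_mul]
  ring

lemma add_mulL2 (V V' : C(Torus d, ℝ)) (f : L2 d) :
    mulL2 (V + V') f = mulL2 V f + mulL2 V' f := by
  refine Lp.ext ?_
  filter_upwards [coeFn_mulL2 (V + V') f, coeFn_mulL2 V f, coeFn_mulL2 V' f,
    Lp.coeFn_add (mulL2 V f) (mulL2 V' f)] with x h1 h2 h3 h4
  rw [h1, h4, Pi.add_apply, h2, h3, ContinuousMap.add_apply, add_mul]

lemma smul_mulL2 (c : ℝ) (V : C(Torus d, ℝ)) (f : L2 d) : mulL2 (c • V) f = c • mulL2 V f := by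
  refine Lp.ext ?_
  filter_upwards [coeFn_mulL2 (c • V) f, coeFn_mulL2 V f,
    Lp.coeFn_smul c (mulL2 V f)] with x h1 h2 h3
  rw [h1, h3, Pi.smul_apply, h2, ContinuousMap.smul_apply, smul_eq_mul, smul_eq_mul, mul_assoc]

lemma mulL2_mulL2 (V V' : C(Torus d, ℝ)) (f : L2 d) : mulL2 V (mulL2 V' f) = mulL2 (V * V') f := by
  refine Lp.ext ?_
  filter_upwards [coeFn_mulL2 V (mulL2 V' f), coeFn_mulL2 V' f, coeFn_mulL2 (V * V') f]
    with x h1 h2 h3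
  rw [h1, h2, h3, ContinuousMap.mul_apply, mul_assoc]

lemma norm_mulL2_le (V : C(Torus d, ℝ)) (f : L2 d) : ‖mulL2 V f‖ ≤ ‖V‖ * ‖f‖ := by
  refine Lp.norm_le_mul_norm_of_ae_le_mul ?_
  filter_upwards [coeFn_mulL2 V f] with x hx
  rw [hx, norm_mul]
  exact mul_le_mul_of_nonneg_right (V.norm_coe_le_norm x) (norm_nonneg _)

/-- Multiplication by a continuous function as a continuous linear map. -/
def mulCLM (V : C(Torus d, ℝ)) : L2 d →L[ℝ] L2 d :=
  LinearMap.mkContinuous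
    { toFun := mulL2 V, map_add' := mulL2_add V, map_smul' := mulL2_smul V } ‖V‖ (norm_mulL2_le V)

lemma mulCLM_apply (V : C(Torus d, ℝ)) (f : L2 d) : mulCLM V f = mulL2 V f := rfl

/-- The operator `(w, v) ↦ (0, V w)` as a continuous linear map. -/
def controlCLM (V : C(Torus d, ℝ)) : State d →L[ℝ] State d :=
  (ContinuousLinearMap.inr ℝ (H1 d) (L2 d)).comp
    ((mulCLM V).comp ((toL2CLM d).comp (ContinuousLinearMap.fst ℝ (H1 d) (L2 d))))

lemma controlCLM_apply (V : C(Torus d, ℝ)) (W : State d) :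
    controlCLM V W = (0, mulL2 V (toL2 W.1)) := rfl

/-- The operator reads only the profile and writes only the velocity. This nilpotency is what makes
large short controls converge to impulses. -/
lemma controlCLM_comp (V V' : C(Torus d, ℝ)) (W : State d) :
    controlCLM V (controlCLM V' W) = 0 := by
  rw [controlCLM_apply, controlCLM_apply, map_zero, ← mulCLM_apply, map_zero]
  rfl

lemma controlCLM_add (V V' : C(Torus d, ℝ)) (W : State d) :
    controlCLM (V + V') W = controlCLM V W + controlCLM V' W := by
  simp [controlCLM_apply, add_mulL2]

lemma controlCLM_smul (c : ℝ) (V : C(Torus d, ℝ)) : controlCLM (c • V) = c • controlCLM V := by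
  refine ContinuousLinearMap.ext fun W => ?_
  simp [controlCLM_apply, smul_mulL2]

lemma controlCLM_zero : controlCLM (0 : C(Torus d, ℝ)) = 0 := by
  simpa using controlCLM_smul 0 (0 : C(Torus d, ℝ))

lemma isStronglyContinuousGroup_freeCLM : IsStronglyContinuousGroup (freeCLM (d := d)) where
  zero_apply := freeCLM_zero
  add_apply := freeCLM_add
  continuous_apply := continuous_freeCLM_apply
  bounded T := ⟨2 + 2 * |T|, by positivity, fun t ht => (norm_freeCLM_le t).trans (by
    have := ht.trans (le_abs_self T)
    linarith)⟩

lemma potential_smul (s : ℝ) (c : Fin (2 * d + 1) → ℝ) : potential (s • c) = s • potential c := by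
  simp [potential, Finset.smul_sum, smul_smul]

lemma potential_zero : potential (0 : Fin (2 * d + 1) → ℝ) = 0 := by
  simp [potential]

/-! ### Approximate steering in small time -/

/-- `W` can be approximately reached from `V` by piecewise constant controls within time `η`. -/
def SteersTo (η : ℝ) (V W : State d) : Prop :=
  ∀ ε > 0, ∃ l : List (ℝ × (Fin (2 * d + 1) → ℝ)), (∀ e ∈ l, 0 < e.1) ∧ listTime l < η ∧
    ‖listFlow freeCLM (fun c => controlCLM (potential c)) l V - W‖ < ε

/-- The second control is chosen first: its flow is Lipschitz, and the constant dictates how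
accurately the first must reach W. -/
lemma SteersTo.trans {η η' : ℝ} {V W Z : State d} (h : SteersTo η V W) (h' : SteersTo η' W Z) :
    SteersTo (η + η') V Z := by
  intro ε hε
  obtain ⟨l', hl', ht', hf'⟩ := h' (ε / 2) (by linarith)
  obtain ⟨C, hC, hlip⟩ := exists_norm_listFlow_sub_le isStronglyContinuousGroup_freeCLM
    (fun c => controlCLM (potential c)) l' hl'
  -- C + 1 instead of C, as C may be zero.
  obtain ⟨l, hl, ht, hf⟩ := h (ε / (2 * (C + 1))) (by positivity)
  refine ⟨l ++ l', fun e he => ?_, ?_, ?_⟩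
  · exact (List.mem_append.mp he).elim (hl e) (hl' e)
  · rw [listTime_append]
    linarith
  · rw [listFlow_append]
    have h1 := hlip (listFlow freeCLM (fun c => controlCLM (potential c)) l V) W
    have h2 : C * ‖listFlow freeCLM (fun c => controlCLM (potential c)) l V - W‖ ≤ ε / 2 := by
      calc _ ≤ (C + 1) * (ε / (2 * (C + 1))) := by
            gcongr
            linarith
        _ = ε / 2 := by field_simp
    calc _ ≤ _ := norm_sub_le_norm_sub_add_norm_sub _
          (listFlow freeCLM (fun c => controlCLM (potential c)) l' W) _
      _ < ε := by linarith

open Filter Topology in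
lemma SteersTo.of_tendsto {ι : Type*} {F : Filter ι} [F.NeBot] {η : ℝ} {V W : State d}
    {Z : ι → State d} (hZ : Tendsto Z F (𝓝 W)) (h : ∀ᶠ i in F, SteersTo η V (Z i)) :
    SteersTo η V W := by
  intro ε hε
  obtain ⟨i, hi, hs⟩ := ((Metric.tendsto_nhds.mp hZ (ε / 2) (by linarith)).and h).exists
  obtain ⟨l, hl, ht, hf⟩ := hs (ε / 2) (by linarith)
  refine ⟨l, hl, ht, ?_⟩
  rw [dist_eq_norm] at hi
  calc _ ≤ _ := norm_sub_le_norm_sub_add_norm_sub _ (Z i) _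
    _ < ε := by linarith

lemma SteersTo.free {η δ : ℝ} (hδ : 0 < δ) (hη : δ < η) (V : State d) :
    SteersTo η V (freeCLM δ V) := by
  intro ε hε
  refine ⟨[(δ, 0)], by simpa using hδ, by simpa [listTime] using hη, ?_⟩
  simp only [listFlow, potential_zero, controlCLM_zero]
  rw [mildFlow_zero isStronglyContinuousGroup_freeCLM hδ.le]
  simpa using hε

/-- The impulse `(w, v) ↦ (w, v + φ w)` can be realised approximately in arbitrarily small time. -/
def Impulsive (φ : C(Torus d, ℝ)) : Prop :=
  ∀ (V : State d) (η : ℝ), 0 < η → SteersTo η V (V + controlCLM φ V)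

open Filter Topology in
lemma impulsive_potential (c : Fin (2 * d + 1) → ℝ) : Impulsive (potential c) := by
  intro V η hη
  have h := tendsto_mildFlow_impulse isStronglyContinuousGroup_freeCLM (controlCLM (potential c))
    (controlCLM_comp _ _) V
  refine SteersTo.of_tendsto h ?_
  filter_upwards [Ioo_mem_nhdsGT hη] with δ hδ ε hε
  refine ⟨[(δ, δ⁻¹ • c)], by simpa using hδ.1, by simpa [listTime] using hδ.2, ?_⟩
  simpa [listFlow, potential_smul, controlCLM_smul] using hε

/-- By nilpotency, (1 + K_ψ)(1 + K_φ) = 1 + K_φ + K_ψ. -/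
lemma Impulsive.add {φ ψ : C(Torus d, ℝ)} (hφ : Impulsive φ) (hψ : Impulsive ψ) :
    Impulsive (φ + ψ) := by
  intro V η hη
  have h := (hφ V (η / 2) (by linarith)).trans (hψ _ (η / 2) (by linarith))
  rw [map_add, controlCLM_comp, add_zero, add_assoc, ← controlCLM_add, add_halves] at h
  exact h

/-- Multiplication by `φ` maps `H¹` into itself. -/
def PreservesH1 (φ : C(Torus d, ℝ)) : Prop := ∀ f : H1 d, mulL2 φ (toL2 f) ∈ h1Submodule d

lemma PreservesH1.add {φ ψ : C(Torus d, ℝ)} (hφ : PreservesH1 φ) (hψ : PreservesH1 ψ) :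
    PreservesH1 (φ + ψ) := by
  intro f
  rw [add_mulL2]
  exact Submodule.add_mem _ (hφ f) (hψ f)

/-! ### Quantitative estimates for the free evolution in small time -/

lemma abs_sinc_sub_one_le (x : ℝ) : |Real.sinc x - 1| ≤ |x| := by
  by_cases hx : x = 0
  · simp [hx]
  -- The cubic bound on x - sin x suffices for |x| ≤ 6; beyond that, |sinc x - 1| ≤ 2 is enough.
  rcases le_total |x| 6 with h6 | h6
  · have h := Real.abs_sub_sin_le x
    have hpos : 0 < |x| := abs_pos.mpr hx
    rw [Real.sinc_of_ne_zero hx, div_sub_one hx, abs_div, div_le_iff₀ hpos, abs_sub_comm]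
    refine h.trans ?_
    nlinarith [mul_nonneg hpos.le hpos.le]
  · have h1 := Real.abs_sinc_le_one x
    have h2 := abs_sub (Real.sinc x) 1
    rw [abs_one] at h2
    linarith

lemma cosMultiplier_sub_one_sq_le (k : Fin d → ℤ) (t : ℝ) :
    (cosMultiplier k t - 1) ^ 2 ≤ t ^ 2 * eigenvalue k := by
  have h := Real.abs_cos_sub_cos_le (Real.sqrt (eigenvalue k) * t) 0
  rw [Real.cos_zero, sub_zero] at h
  have h2 := sq_le_sq.mpr h
  rw [mul_pow, Real.sq_sqrt (eigenvalue_nonneg k)] at h2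
  rw [cosMultiplier]
  linarith

/-- This and the next three estimates are linear in t so as to survive multiplication by δ^(-1/2) in
`tendsto_conjugated_freeCLM`. For those that start from a velocity g, it is the H¹ regularity of g
that yields the rate. -/
lemma norm_freeCLM_inr_fst_le (t : ℝ) (g : H1 d) :
    ‖(freeCLM t ((0 : H1 d), toL2 g)).1‖ ≤ |t| * ‖g‖ := by
  refine (sq_le_sq₀ (norm_nonneg _) (by positivity)).mp ?_
  rw [mul_pow, sq_abs]
  refine hasSum_le (fun k => ?_) (H1.hasSum_norm_sq _) ((H1.hasSum_norm_sq g).mul_left _)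
  rw [freeCLM_apply, coeff_freeEvolution_fst, profileCoeff]
  simp only [map_zero, coeff_zero, mul_zero, zero_add, norm_ofReal_mul_sq]
  have := mul_le_mul_of_nonneg_right (sineMultiplier_sq_le k t) (mul_nonneg
    (add_nonneg zero_le_one (eigenvalue_nonneg k)) (sq_nonneg ‖coeff (toL2 g) k‖))
  linarith

lemma norm_freeCLM_inr_snd_sub_le (t : ℝ) (g : H1 d) :
    ‖(freeCLM t ((0 : H1 d), toL2 g)).2 - toL2 g‖ ≤ |t| * ‖g‖ := by
  refine (sq_le_sq₀ (norm_nonneg _) (by positivity)).mp ?_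
  rw [mul_pow, sq_abs]
  refine hasSum_le (fun k => ?_) (hasSum_norm_coeff_sq _) ((H1.hasSum_norm_sq g).mul_left _)
  rw [coeff_sub, freeCLM_apply, coeff_freeEvolution_snd, velocityCoeff]
  have e : -((eigenvalue k * sineMultiplier k t : ℝ) * coeff (toL2 (0 : H1 d)) k) +
      cosMultiplier k t * coeff (toL2 g) k - coeff (toL2 g) k =
        ((cosMultiplier k t - 1 : ℝ) : ℂ) * coeff (toL2 g) k := by
    simp only [map_zero, coeff_zero]
    push_cast
    ring
  simp only at e ⊢
  rw [e, norm_ofReal_mul_sq]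
  have := mul_le_mul_of_nonneg_right (cosMultiplier_sub_one_sq_le k t)
    (sq_nonneg ‖coeff (toL2 g) k‖)
  nlinarith [mul_nonneg (sq_nonneg t) (sq_nonneg ‖coeff (toL2 g) k‖)]

lemma norm_inv_smul_freeCLM_inr_fst_sub_le {t : ℝ} (ht : t ≠ 0) (g : H1 d) :
    ‖t⁻¹ • toL2 (freeCLM t ((0 : H1 d), toL2 g)).1 - toL2 g‖ ≤ |t| * ‖g‖ := by
  refine (sq_le_sq₀ (norm_nonneg _) (by positivity)).mp ?_
  rw [mul_pow, sq_abs]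
  refine hasSum_le (fun k => ?_) (hasSum_norm_coeff_sq _) ((H1.hasSum_norm_sq g).mul_left _)
  have e : coeff (t⁻¹ • toL2 (freeCLM t ((0 : H1 d), toL2 g)).1 - toL2 g) k =
      ((Real.sinc (Real.sqrt (eigenvalue k) * t) - 1 : ℝ) : ℂ) * coeff (toL2 g) k := by
    have ht' : (t : ℂ) ≠ 0 := by exact_mod_cast ht
    rw [coeff_sub, coeff_smul, freeCLM_apply, coeff_freeEvolution_fst, profileCoeff]
    simp only [map_zero, coeff_zero, mul_zero, zero_add, sineMultiplier]
    push_cast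
    field_simp
  rw [e, norm_ofReal_mul_sq]
  have h := sq_le_sq.mpr (abs_sinc_sub_one_le (Real.sqrt (eigenvalue k) * t))
  rw [mul_pow, Real.sq_sqrt (eigenvalue_nonneg k)] at h
  have := mul_le_mul_of_nonneg_right h (sq_nonneg ‖coeff (toL2 g) k‖)
  nlinarith [mul_nonneg (sq_nonneg t) (sq_nonneg ‖coeff (toL2 g) k‖)]

lemma norm_toL2_freeCLM_fst_sub_le (t : ℝ) (W : State d) :
    ‖toL2 (freeCLM t W).1 - toL2 W.1‖ ≤ 2 * |t| * ‖W‖ := by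
  have h1 : ‖W.1‖ ^ 2 ≤ ‖W‖ ^ 2 := pow_le_pow_left₀ (norm_nonneg _) (norm_fst_le W) 2
  have h2 : ‖W.2‖ ^ 2 ≤ ‖W‖ ^ 2 := pow_le_pow_left₀ (norm_nonneg _) (norm_snd_le W) 2
  refine (sq_le_sq₀ (norm_nonneg _) (by positivity)).mp ?_
  have h : ‖toL2 (freeCLM t W).1 - toL2 W.1‖ ^ 2 ≤
      2 * t ^ 2 * ‖W.1‖ ^ 2 + 2 * t ^ 2 * ‖W.2‖ ^ 2 := by
    refine hasSum_le (fun k => ?_) (hasSum_norm_coeff_sq _)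
      (((H1.hasSum_norm_sq W.1).mul_left _).add ((hasSum_norm_coeff_sq W.2).mul_left _))
    have e : coeff (toL2 (freeCLM t W).1 - toL2 W.1) k =
        ((cosMultiplier k t - 1 : ℝ) : ℂ) * coeff (toL2 W.1) k +
          sineMultiplier k t * coeff W.2 k := by
      rw [coeff_sub, freeCLM_apply, coeff_freeEvolution_fst, profileCoeff]
      push_cast
      ring
    rw [e]
    refine (norm_add_sq_le_two_mul _ _).trans ?_
    rw [norm_ofReal_mul_sq, norm_ofReal_mul_sq]
    have e1 := mul_le_mul_of_nonneg_right (cosMultiplier_sub_one_sq_le k t)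
      (sq_nonneg ‖coeff (toL2 W.1) k‖)
    have e2 := mul_le_mul_of_nonneg_right (sineMultiplier_sq_le k t) (sq_nonneg ‖coeff W.2 k‖)
    nlinarith [mul_nonneg (sq_nonneg t) (sq_nonneg ‖coeff (toL2 W.1) k‖)]
  rw [mul_pow, mul_pow, sq_abs]
  nlinarith [mul_le_mul_of_nonneg_left h1 (sq_nonneg t),
    mul_le_mul_of_nonneg_left h2 (sq_nonneg t)]

open Filter Topology in
/-- Conjugating the free evolution by opposite large impulses yields `-φ²` in the limit. -/
lemma tendsto_conjugated_freeCLM {φ : C(Torus d, ℝ)} (hφ : PreservesH1 φ) (W : State d) :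
    Tendsto (fun δ : ℝ => freeCLM δ (W + controlCLM ((√δ)⁻¹ • φ) W) +
        controlCLM (-(√δ)⁻¹ • φ) (freeCLM δ (W + controlCLM ((√δ)⁻¹ • φ) W)))
      (𝓝[>] 0) (𝓝 (W + controlCLM (-(φ * φ)) W)) := by
  -- The velocity φ w created by the impulse must lie in H¹ for the linear rates to apply; this is
  -- why φ has to preserve H¹.
  obtain ⟨g, hg⟩ : ∃ g : H1 d, toL2 g = mulL2 φ (toL2 W.1) := ⟨⟨_, hφ W.1⟩, rfl⟩
  rw [tendsto_iff_norm_sub_tendsto_zero]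
  let bound : ℝ → ℝ := fun δ => ‖freeCLM δ W - W‖ + √δ * ‖g‖ + ‖φ‖ * (√δ * (2 * ‖W‖)) +
    ‖φ‖ * (δ * ‖g‖)
  have hb : Tendsto bound (𝓝[>] 0) (𝓝 0) := by
    have hc : Continuous bound := by
      have := (continuous_freeCLM_apply W).sub (continuous_const (y := W))
      have := this.norm
      fun_prop
    have := hc.tendsto 0
    simp only [bound, freeCLM_zero, sub_self, norm_zero, Real.sqrt_zero, zero_mul, mul_zero,
      add_zero] at this
    exact this.mono_left nhdsWithin_le_nhds
  refine squeeze_zero' (Eventually.of_forall fun _ => norm_nonneg _) ?_ hb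
  filter_upwards [self_mem_nhdsWithin] with δ hδ
  have hδ : 0 < δ := hδ
  have hs : 0 < √δ := Real.sqrt_pos.mpr hδ
  have hss : √δ * √δ = δ := Real.mul_self_sqrt hδ.le
  set s := (√δ)⁻¹ with hsdef
  have hs0 : 0 < s := inv_pos.mpr hs
  have hsδ : s * δ = √δ := by
    calc s * δ = s * (√δ * √δ) := by rw [hss]
      _ = √δ := by rw [hsdef]; field_simp
  have hs2 : s * s = δ⁻¹ := by rw [hsdef, ← mul_inv, hss]
  set A := freeCLM δ W with hA
  set B := freeCLM δ ((0 : H1 d), toL2 g) with hB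
  -- A evolves the original state, B the velocity g left by the first impulse, whose strength is s =
  -- δ^(-1/2).
  have e1 : freeCLM δ (W + controlCLM (s • φ) W) = A + s • B := by
    rw [controlCLM_smul, map_add, _root_.smul_apply, map_smul, controlCLM_apply, ← hg]
  have eM : mulL2 (φ * φ) (toL2 W.1) = mulCLM φ (toL2 g) := by
    rw [hg, mulCLM_apply, mulL2_mulL2]
  have hneg : controlCLM (-(φ * φ)) W = -((0 : H1 d), mulCLM φ (toL2 g)) := by
    have h := congrArg (fun L => L W) (controlCLM_smul (-1) (φ * φ))
    simp only [neg_one_smul, _root_.smul_apply] at h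
    rw [h, controlCLM_apply, eM]
  have e2 : controlCLM (-s • φ) (A + s • B) =
      ((0 : H1 d), -(s • mulCLM φ (toL2 A.1)) - (s * s) • mulCLM φ (toL2 B.1)) := by
    rw [controlCLM_smul, _root_.smul_apply, controlCLM_apply, ← mulCLM_apply, Prod.smul_mk,
      smul_zero, Prod.fst_add, Prod.smul_fst, map_add, map_smul, map_add, map_smul, smul_add,
      smul_smul]
    congr 1
    module
  rw [e1, e2, hneg]
  have b1 := norm_freeCLM_inr_fst_le δ g
  have b2 := norm_freeCLM_inr_snd_sub_le δ g
  have b3 := norm_inv_smul_freeCLM_inr_fst_sub_le hδ.ne' g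
  have b4 := norm_toL2_freeCLM_fst_sub_le δ W
  rw [abs_of_pos hδ] at b1 b2 b3 b4
  rw [← hB] at b1 b2 b3
  rw [← hA] at b4
  have hA1 : ‖A.1 - W.1‖ ≤ ‖A - W‖ := norm_fst_le (A - W)
  have hA2 : ‖A.2 - W.2‖ ≤ ‖A - W‖ := norm_snd_le (A - W)
  refine max_le ?_ ?_
  · have e : (A + s • B + ((0 : H1 d), -(s • mulCLM φ (toL2 A.1)) -
        (s * s) • mulCLM φ (toL2 B.1)) - (W + -((0 : H1 d), mulCLM φ (toL2 g)))).1 =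
          (A.1 - W.1) + s • B.1 := by
      simp only [Prod.fst_sub, Prod.fst_add, Prod.smul_fst, Prod.fst_neg]
      module
    rw [e]
    have h1 : ‖s • B.1‖ ≤ √δ * ‖g‖ := by
      rw [norm_smul, Real.norm_of_nonneg hs0.le, ← hsδ, mul_assoc]
      gcongr
    have h2 : 0 ≤ ‖φ‖ * (√δ * (2 * ‖W‖)) := by positivity
    have h3 : 0 ≤ ‖φ‖ * (δ * ‖g‖) := by positivity
    have := norm_add_le (A.1 - W.1) (s • B.1)
    simp only [bound, ← hA]
    linarith
  -- The singular terms s g and -s φ w from the two impulses cancel because g = φ w. The limit -φ g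
  -- comes from s² = δ⁻¹ together with δ⁻¹ B.1 → g in L².
  · have e : (A + s • B + ((0 : H1 d), -(s • mulCLM φ (toL2 A.1)) -
        (s * s) • mulCLM φ (toL2 B.1)) - (W + -((0 : H1 d), mulCLM φ (toL2 g)))).2 =
          (A.2 - W.2) + s • (B.2 - toL2 g) + -(mulCLM φ (s • (toL2 A.1 - toL2 W.1))) +
            -(mulCLM φ (δ⁻¹ • toL2 B.1 - toL2 g)) := by
      simp only [Prod.snd_sub, Prod.snd_add, Prod.smul_snd, Prod.snd_neg, map_sub, map_smul, hs2]
      have : mulCLM φ (toL2 W.1) = toL2 g := hg.symm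
      rw [this]
      module
    rw [e]
    have hmul : ∀ f : L2 d, ‖-(mulCLM φ f)‖ ≤ ‖φ‖ * ‖f‖ := fun f => by
      rw [norm_neg]
      exact norm_mulL2_le φ f
    have h1 : ‖s • (B.2 - toL2 g)‖ ≤ √δ * ‖g‖ := by
      rw [norm_smul, Real.norm_of_nonneg hs0.le, ← hsδ, mul_assoc]
      gcongr
    have h2 : ‖-(mulCLM φ (s • (toL2 A.1 - toL2 W.1)))‖ ≤ ‖φ‖ * (√δ * (2 * ‖W‖)) := by
      refine (hmul _).trans ?_
      rw [norm_smul, Real.norm_of_nonneg hs0.le, ← hsδ, mul_assoc]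
      gcongr
      linarith
    have h3 : ‖-(mulCLM φ (δ⁻¹ • toL2 B.1 - toL2 g))‖ ≤ ‖φ‖ * (δ * ‖g‖) := by
      refine (hmul _).trans ?_
      gcongr
    refine (norm_add_le _ _).trans (add_le_add ((norm_add_le _ _).trans (add_le_add
      ((norm_add_le _ _).trans (add_le_add hA2 h1)) h2)) h3)

-- All real multiples of φ are required, since the framing impulses have the unbounded strengths
-- ±δ^(-1/2). Impulse, free evolution and opposite impulse get a third of the time each.
open Filter Topology in
lemma impulsive_neg_mul_self {φ : C(Torus d, ℝ)} (hφ : ∀ s : ℝ, Impulsive (s • φ))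
    (hp : PreservesH1 φ) : Impulsive (-(φ * φ)) := by
  intro V η hη
  refine SteersTo.of_tendsto (tendsto_conjugated_freeCLM hp V) ?_
  filter_upwards [Ioo_mem_nhdsGT (show (0 : ℝ) < η / 3 by linarith)] with δ hδ
  have h := ((hφ (√δ)⁻¹ V (η / 3) (by linarith)).trans (SteersTo.free hδ.1 hδ.2 _)).trans
    (hφ (-(√δ)⁻¹) _ (η / 3) (by linarith))
  rwa [add_thirds] at h

/-! ### Trigonometric potentials -/

/-- The real trigonometric function `Re (b e^{imx})`. -/
def trigMode (b : ℂ) (m : Fin d → ℤ) : C(Torus d, ℝ) where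
  toFun x := (b * character m x).re
  continuous_toFun := by fun_prop

lemma trigMode_apply (b : ℂ) (m : Fin d → ℤ) (x : Torus d) :
    trigMode b m x = (b * character m x).re := rfl

lemma smul_trigMode (s : ℝ) (b : ℂ) (m : Fin d → ℤ) : s • trigMode b m = trigMode (s * b) m := by
  ext x
  simp [trigMode_apply, mul_assoc]

lemma modeFun_eq_trigMode (a : ℂ) (k : Fin d → ℤ) :
    modeFun a k = trigMode (a * modeScale d) k := by
  ext x
  change (a * eigenfunction k x).re = _
  rw [trigMode_apply, eigenfunction_apply, mul_assoc]

lemma coeff_mulL2_trigMode (b : ℂ) (m : Fin d → ℤ) (f : L2 d) (k : Fin d → ℤ) :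
    coeff (mulL2 (trigMode b m) f) k =
      b / 2 * coeff f (k - m) + conj b / 2 * coeff f (k + m) := by
  rw [coeff, coeff, coeff, ← integral_const_mul, ← integral_const_mul,
    ← integral_add ((integrable_coeff f _).const_mul _) ((integrable_coeff f _).const_mul _)]
  refine integral_congr_ae ?_
  filter_upwards [coeFn_mulL2 (trigMode b m) f] with x hx
  rw [hx, trigMode_apply, Complex.ofReal_mul, Complex.re_eq_add_conj]
  simp only [eigenfunction_apply, sub_eq_add_neg, character_add, character_neg, map_mul,
    Complex.conj_ofReal, Complex.conj_conj]
  ring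

lemma eigenvalue_add_le (k m : Fin d → ℤ) :
    eigenvalue (k + m) ≤ 2 * eigenvalue k + 2 * eigenvalue m := by
  simp only [eigenvalue, Finset.mul_sum, ← Finset.sum_add_distrib]
  refine Finset.sum_le_sum fun i _ => ?_
  rw [Pi.add_apply, Int.cast_add]
  nlinarith [sq_nonneg ((k i : ℝ) - m i)]

/-- Shifting frequencies by a fixed m preserves H¹ decay because |k|² ≤ 2|k + m|² + 2|m|². -/
lemma summable_eigenvalue_mul_coeff_shift (f : H1 d) (m : Fin d → ℤ) :
    Summable fun k => eigenvalue k * ‖coeff (toL2 f) (k + m)‖ ^ 2 := by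
  have h1 : Summable fun k : Fin d → ℤ => eigenvalue k * ‖coeff (toL2 f) k‖ ^ 2 :=
    (mem_h1Submodule_iff (toL2 f)).mp f.2
  have h2 := (h1.mul_left 2).add
    ((hasSum_norm_coeff_sq (toL2 f)).summable.mul_left (2 * eigenvalue m))
  have h3 := (Equiv.addRight m).summable_iff.mpr h2
  refine h3.of_nonneg_of_le (fun k => mul_nonneg (eigenvalue_nonneg k) (sq_nonneg _)) fun k => ?_
  have h4 := eigenvalue_add_le (k + m) (-m)
  rw [add_neg_cancel_right, eigenvalue_neg] at h4
  have := mul_le_mul_of_nonneg_right h4 (sq_nonneg ‖coeff (toL2 f) (k + m)‖)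
  simp only [Function.comp, Equiv.coe_addRight]
  linarith

lemma preservesH1_trigMode (b : ℂ) (m : Fin d → ℤ) : PreservesH1 (trigMode b m) := by
  intro f
  rw [mem_h1Submodule_iff]
  have h := ((summable_eigenvalue_mul_coeff_shift f (-m)).mul_left (2 * ‖b / 2‖ ^ 2)).add
    ((summable_eigenvalue_mul_coeff_shift f m).mul_left (2 * ‖conj b / 2‖ ^ 2))
  refine h.of_nonneg_of_le (fun k => mul_nonneg (eigenvalue_nonneg k) (sq_nonneg _)) fun k => ?_
  rw [coeff_mulL2_trigMode, sub_eq_add_neg]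
  have h1 := norm_add_sq_le_two_mul (b / 2 * coeff (toL2 f) (k + -m))
    (conj b / 2 * coeff (toL2 f) (k + m))
  rw [norm_mul, norm_mul, mul_pow, mul_pow] at h1
  have := mul_le_mul_of_nonneg_left h1 (eigenvalue_nonneg k)
  linarith

lemma controlMode_cos (i : Fin d) :
    controlMode (Fin.succ (⟨2 * i, by omega⟩ : Fin (2 * d))) = trigMode 1 (Pi.single i 1) := by
  ext x
  rw [trigMode_apply, character_single, one_mul]
  have hi : (⟨2 * (i : ℕ) / 2, by omega⟩ : Fin d) = i := Fin.ext (by simp)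
  simp only [controlMode, Fin.cases_succ, Nat.mul_mod_right, if_true, ContinuousMap.coe_mk, hi]
  induction x i using QuotientAddGroup.induction_on with
  | H r =>
    have e : (fourier 1 ((r : ℝ) : AddCircle (2 * Real.pi)) : ℂ) = Complex.exp (r * Complex.I) := by
      rw [fourier_coe_apply]
      congr 1
      push_cast
      have : (Real.pi : ℂ) ≠ 0 := by exact_mod_cast Real.pi_ne_zero
      field_simp
    refine Eq.trans ?_ (congrArg Complex.re e).symm
    rw [Complex.exp_ofReal_mul_I_re]
    exact Real.Angle.cos_coe r

lemma controlMode_sin (i : Fin d) :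
    controlMode (Fin.succ (⟨2 * i + 1, by omega⟩ : Fin (2 * d))) =
      trigMode (-Complex.I) (Pi.single i 1) := by
  ext x
  rw [trigMode_apply, character_single]
  have hi : (⟨(2 * (i : ℕ) + 1) / 2, by omega⟩ : Fin d) = i := Fin.ext (by simp; omega)
  have hm : ¬ (2 * (i : ℕ) + 1) % 2 = 0 := by omega
  simp only [controlMode, Fin.cases_succ, hm, if_false, ContinuousMap.coe_mk, hi]
  induction x i using QuotientAddGroup.induction_on with
  | H r =>
    have e : (fourier 1 ((r : ℝ) : AddCircle (2 * Real.pi)) : ℂ) = Complex.exp (r * Complex.I) := by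
      rw [fourier_coe_apply]
      congr 1
      push_cast
      have : (Real.pi : ℂ) ≠ 0 := by exact_mod_cast Real.pi_ne_zero
      field_simp
    refine Eq.trans ?_ (congrArg (fun z => (-Complex.I * z).re) e).symm
    simp only [neg_mul, Complex.neg_re, Complex.I_mul_re, neg_neg, Complex.exp_ofReal_mul_I_im]
    exact Real.Angle.sin_coe r

lemma potential_single (j : Fin (2 * d + 1)) (s : ℝ) :
    potential (Pi.single j s) = s • controlMode j := by
  rw [potential, Finset.sum_eq_single j]
  · simp
  · intro i _ hi
    simp [Pi.single_eq_of_ne hi]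
  · simp

lemma impulsive_const (s : ℝ) : Impulsive (s • (1 : C(Torus d, ℝ))) := by
  have h := impulsive_potential (Pi.single (0 : Fin (2 * d + 1)) s)
  rwa [potential_single] at h

lemma impulsive_trigMode_zero (b : ℂ) : Impulsive (trigMode b (0 : Fin d → ℤ)) := by
  convert impulsive_const (d := d) b.re using 1
  ext x
  simp [trigMode_apply, character_zero]

lemma impulsive_trigMode_single (b : ℂ) (i : Fin d) : Impulsive (trigMode b (Pi.single i 1)) := by
  have h1 := impulsive_potential (Pi.single (Fin.succ (⟨2 * i, by omega⟩ : Fin (2 * d))) b.re)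
  have h2 := impulsive_potential (Pi.single (Fin.succ (⟨2 * i + 1, by omega⟩ : Fin (2 * d)))
    (-b.im))
  rw [potential_single, controlMode_cos] at h1
  rw [potential_single, controlMode_sin] at h2
  convert h1.add h2 using 1
  ext x
  simp [trigMode_apply]
  ring

lemma trigMode_neg (b : ℂ) (m : Fin d → ℤ) : trigMode b (-m) = trigMode (conj b) m := by
  ext x
  rw [trigMode_apply, trigMode_apply, character_neg, ← Complex.conj_re, map_mul,
    Complex.conj_conj]

/-- With z = e^(ikx) and y = e^(imx), the two squares add up to |z + conj (b y)|² = 1 + |b|² + 2 Re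
(b z y). The quarter-turned pair removes the unwanted frequencies 2k, 2m and k - m that a single
square would contain. -/
lemma two_smul_trigMode_add (b : ℂ) (k m : Fin d → ℤ) :
    (-2 : ℝ) • trigMode b (k + m) =
      -((trigMode 1 k + trigMode b m) * (trigMode 1 k + trigMode b m)) +
      -((trigMode (-Complex.I) k + trigMode (Complex.I * b) m) *
        (trigMode (-Complex.I) k + trigMode (Complex.I * b) m)) +
      (1 + ‖b‖ ^ 2) • (1 : C(Torus d, ℝ)) := by
  ext x
  simp only [ContinuousMap.smul_apply, ContinuousMap.add_apply, ContinuousMap.neg_apply,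
    ContinuousMap.mul_apply, ContinuousMap.one_apply, trigMode_apply, character_add, smul_eq_mul]
  have hz := congrArg (· ^ 2) (norm_character k x)
  have hy := congrArg (· ^ 2) (norm_character m x)
  simp only [Complex.sq_norm, Complex.normSq_apply, one_pow] at hz hy
  generalize character k x = z at *
  generalize character m x = y at *
  rw [Complex.sq_norm, Complex.normSq_apply]
  simp only [Complex.mul_re, Complex.mul_im, Complex.neg_re, Complex.neg_im, Complex.I_re,
    Complex.I_im, Complex.one_re, Complex.one_im]
  linear_combination hz + (b.re * b.re + b.im * b.im) * hy

lemma impulsive_trigMode_add {k m : Fin d → ℤ} (hk : ∀ b, Impulsive (trigMode b k))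
    (hm : ∀ b, Impulsive (trigMode b m)) (b : ℂ) : Impulsive (trigMode b (k + m)) := by
  have key : ∀ b, Impulsive ((-2 : ℝ) • trigMode b (k + m)) := by
    intro b
    rw [two_smul_trigMode_add]
    refine ((impulsive_neg_mul_self (fun s => ?_) ?_).add
      (impulsive_neg_mul_self (fun s => ?_) ?_)).add (impulsive_const _)
    · rw [smul_add, smul_trigMode, smul_trigMode]
      exact (hk _).add (hm _)
    · exact (preservesH1_trigMode _ _).add (preservesH1_trigMode _ _)
    · rw [smul_add, smul_trigMode, smul_trigMode]
      exact (hk _).add (hm _)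
    · exact (preservesH1_trigMode _ _).add (preservesH1_trigMode _ _)
  -- Only negative squares are available, but the amplitude is an arbitrary complex number and
  -- absorbs the factor -2.
  have h := key (-b / 2)
  rw [smul_trigMode] at h
  convert h using 2
  push_cast
  ring

/-- The frequencies all of whose trigonometric functions are impulsive form a subgroup. -/
def impulsiveFrequencies (d : ℕ) : AddSubgroup (Fin d → ℤ) where
  carrier := {m | ∀ b, Impulsive (trigMode b m)}
  zero_mem' := impulsive_trigMode_zero
  add_mem' hk hm := impulsive_trigMode_add hk hm
  neg_mem' hm b := by
    rw [trigMode_neg]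
    exact hm _

lemma impulsive_trigMode (b : ℂ) (m : Fin d → ℤ) : Impulsive (trigMode b m) := by
  suffices m ∈ impulsiveFrequencies d from this b
  rw [← Finset.univ_sum_single m]
  refine AddSubgroup.sum_mem _ fun i _ => ?_
  have h : (Pi.single i (m i) : Fin d → ℤ) = m i • Pi.single i 1 := by
    rw [← Pi.single_smul, smul_eq_mul, mul_one]
  rw [h]
  have hi : (Pi.single i 1 : Fin d → ℤ) ∈ impulsiveFrequencies d := fun b =>
    impulsive_trigMode_single b i
  exact AddSubgroup.zsmul_mem _ hi _

/-- Real trigonometric polynomials. -/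
def trigPolynomials (d : ℕ) : Submodule ℝ C(Torus d, ℝ) :=
  Submodule.span ℝ (range fun p : ℂ × (Fin d → ℤ) => trigMode p.1 p.2)

lemma impulsive_of_mem_trigPolynomials {φ : C(Torus d, ℝ)} (hφ : φ ∈ trigPolynomials d) :
    Impulsive φ := by
  have h : ∀ s : ℝ, Impulsive (s • φ) := by
    induction hφ using Submodule.span_induction with
    | mem x hx =>
      obtain ⟨p, rfl⟩ := hx
      intro s
      simp only [smul_trigMode]
      exact impulsive_trigMode _ _
    | zero =>
      intro s
      have := impulsive_const (d := d) 0
      rwa [zero_smul, ← smul_zero s] at this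
    | add x y _ _ hx hy =>
      intro s
      rw [smul_add]
      exact (hx s).add (hy s)
    | smul a x _ hx =>
      intro s
      rw [smul_smul]
      exact hx _
  simpa using h 1

/-! ### Zeros of trigonometric polynomials -/

/-- Finitely many frequencies are separated by some integer direction. -/
lemma exists_separating_direction (S : Finset (Fin d → ℤ)) :
    ∃ θ : Fin d → ℤ, ∀ k ∈ S, ∀ l ∈ S, ∑ i, k i * θ i = ∑ i, l i * θ i → k = l := by
  -- The direction is sought in the form θ = (1, N, N², …), for which m · θ is the value of P m at
  -- N. It suffices that N is not a root of the product Q over all pairs of distinct frequencies.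
  let P : (Fin d → ℤ) → Polynomial ℤ := fun m => ∑ i : Fin d, Polynomial.monomial (i : ℕ) (m i)
  have hcoef : ∀ m i, (P m).coeff (i : Fin d) = m i := fun m i => by
    simp [P, Polynomial.finsetSum_coeff, Polynomial.coeff_monomial, Fin.val_inj]
  have hP : ∀ m, m ≠ 0 → P m ≠ 0 := fun m hm h => hm (funext fun i => by
    rw [← hcoef m i, h, Polynomial.coeff_zero, Pi.zero_apply])
  let Q : Polynomial ℤ := ∏ p ∈ S ×ˢ S, if p.1 = p.2 then 1 else P (p.1 - p.2)
  have hQ : Q ≠ 0 := by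
    rw [Finset.prod_ne_zero_iff]
    intro p _
    split_ifs with h
    · exact one_ne_zero
    · exact hP _ (sub_ne_zero.mpr h)
  obtain ⟨N, hN⟩ : ∃ N : ℤ, Q.eval N ≠ 0 := by
    by_contra! h
    exact hQ (Polynomial.funext fun r => by simpa using h r)
  refine ⟨fun i => N ^ (i : ℕ), fun k hk l hl h => ?_⟩
  by_contra hne
  rw [Polynomial.eval_prod, Finset.prod_ne_zero_iff] at hN
  have := hN (k, l) (Finset.mk_mem_product hk hl)
  simp only [hne, if_false] at this
  apply this
  simp only [P, Polynomial.eval_finsetSum, Polynomial.eval_monomial, Pi.sub_apply, sub_mul,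
    Finset.sum_sub_distrib, h, sub_self]

/-- A nontrivial exponential sum on the circle has finitely many zeros. -/
lemma finite_zeros_fourier_sum {ι : Type*} (S : Finset ι) (n : ι → ℤ) (hn : InjOn n S) (b : ι → ℂ)
    {k₀ : ι} (hk₀ : k₀ ∈ S) (hb : b k₀ ≠ 0) :
    {s : AddCircle (2 * Real.pi) | ∑ k ∈ S, b k * (fourier (n k) s : ℂ) = 0}.Finite := by
  classical
  obtain ⟨N, hN⟩ : ∃ N : ℤ, ∀ k ∈ S, 0 ≤ n k + N := by
    refine ⟨∑ k ∈ S, |n k|, fun k hk => ?_⟩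
    have h1 := Finset.single_le_sum (f := fun k => |n k|) (fun i _ => abs_nonneg _) hk
    have h2 := neg_abs_le (n k)
    linarith
  -- With z = e^(is), multiplication by z^N turns the exponential sum into a polynomial in z;
  -- injectivity of n on S keeps the coefficient `b k₀` uncancelled.
  let P : Polynomial ℂ := ∑ k ∈ S, Polynomial.monomial (n k + N).toNat (b k)
  have hP : P ≠ 0 := by
    intro h
    have hc : P.coeff (n k₀ + N).toNat = b k₀ := by
      simp only [P, Polynomial.finsetSum_coeff, Polynomial.coeff_monomial]
      rw [Finset.sum_eq_single k₀]
      · simp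
      · intro k hk hne
        rw [if_neg]
        intro he
        apply hne
        apply hn hk hk₀
        have h1 := hN k hk
        have h2 := hN k₀ hk₀
        omega
      · exact fun h => absurd hk₀ h
    rw [h, Polynomial.coeff_zero] at hc
    exact hb hc.symm
  have hroots : {z : ℂ | P.IsRoot z}.Finite := Polynomial.finite_setOfPred_isRoot hP
  have hinj : Function.Injective fun s : AddCircle (2 * Real.pi) => (s.toCircle : ℂ) :=
    fun s t h => AddCircle.injective_toCircle Real.two_pi_pos.ne' (Circle.ext h)
  refine (hroots.preimage hinj.injOn).subset fun s hs => ?_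
  simp only [mem_ofPred_eq, mem_preimage] at hs ⊢
  have hz : (s.toCircle : ℂ) ≠ 0 := Circle.coe_ne_zero _
  have hf : ∀ m : ℤ, (fourier m s : ℂ) = (s.toCircle : ℂ) ^ m := fun m => by
    rw [fourier_apply, AddCircle.toCircle_zsmul, Circle.coe_zpow]
  rw [Polynomial.IsRoot, Polynomial.eval_finsetSum]
  have : ∀ k ∈ S, Polynomial.eval (s.toCircle : ℂ) (Polynomial.monomial (n k + N).toNat (b k)) =
      (s.toCircle : ℂ) ^ N * (b k * (fourier (n k) s : ℂ)) := fun k hk => by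
    rw [Polynomial.eval_monomial, hf, ← zpow_natCast, Int.toNat_of_nonneg (hN k hk),
      zpow_add₀ hz]
    ring
  rw [Finset.sum_congr rfl this, ← Finset.mul_sum, hs, mul_zero]

/-- Along the closed line of direction θ through x, the character of frequency k is an exponential
of frequency k · θ. This reduces zeros on the torus to zeros on the circle. -/
lemma character_add_zsmul (k θ : Fin d → ℤ) (x : Torus d) (s : AddCircle (2 * Real.pi)) :
    character k (x + fun i => θ i • s) =
      character k x * (fourier (∑ i, k i * θ i) s : ℂ) := by
  have h : ∀ S : Finset (Fin d), (fourier (∑ i ∈ S, k i * θ i) s : ℂ) =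
      ∏ i ∈ S, (fourier (k i) (θ i • s) : ℂ) := by
    intro S
    induction S using Finset.induction_on with
    | empty => simp
    | insert a S ha ih =>
      rw [Finset.sum_insert ha, Finset.prod_insert ha, fourier_add, ih]
      simp [fourier_apply, smul_smul]
  rw [h, character_apply, character_apply, ← Finset.prod_mul_distrib]
  refine Finset.prod_congr rfl fun i _ => ?_
  simp [fourier_apply, smul_add, AddCircle.toCircle_add]

instance nullSingletonClass_addCircle :
    NullSingletonClass (volume : Measure (AddCircle (2 * Real.pi))) where
  measure_singleton x := by
    have h := AddCircle.volume_closedBall (2 * Real.pi) (x := x) 0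
    rw [Metric.closedBall_zero] at h
    rw [h, mul_zero, min_eq_right Real.two_pi_pos.le, ENNReal.ofReal_zero]

/-- A nontrivial trigonometric polynomial vanishes almost nowhere. -/
lemma ae_sum_character_ne_zero (S : Finset (Fin d → ℤ)) (a : (Fin d → ℤ) → ℂ) {k₀ : Fin d → ℤ}
    (hk₀ : k₀ ∈ S) (ha : a k₀ ≠ 0) : ∀ᵐ x : Torus d, ∑ k ∈ S, a k * character k x ≠ 0 := by
  obtain ⟨θ, hθ⟩ := exists_separating_direction S
  have hθ' : InjOn (fun k : Fin d → ℤ => ∑ i, k i * θ i) S := fun k hk l hl h => hθ k hk l hl h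
  have h1 : ∀ x : Torus d, ∀ᵐ s : AddCircle (2 * Real.pi),
      ∑ k ∈ S, a k * character k (x + fun i => θ i • s) ≠ 0 := by
    intro x
    have hne : a k₀ * character k₀ x ≠ 0 := by
      refine mul_ne_zero ha fun h => ?_
      have := norm_character k₀ x
      rw [h, norm_zero] at this
      exact zero_ne_one this
    have := (finite_zeros_fourier_sum S _ hθ' (fun k => a k * character k x) hk₀ hne)
    have h0 := this.measure_zero (volume : Measure (AddCircle (2 * Real.pi)))
    rw [ae_iff]
    simpa only [character_add_zsmul, not_not, ← mul_assoc] using! h0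
  have hc : Continuous fun p : Torus d × AddCircle (2 * Real.pi) =>
      ∑ k ∈ S, a k * character k (p.1 + fun i => θ i • p.2) := by fun_prop
  have hm : MeasurableSet {p : Torus d × AddCircle (2 * Real.pi) |
      ∑ k ∈ S, a k * character k (p.1 + fun i => θ i • p.2) ≠ 0} :=
    (isOpen_ne_fun hc continuous_const).measurableSet
  -- By Fubini, for almost every s the sum translated by s θ vanishes almost nowhere. A single such
  -- s suffices, as the measure is translation invariant.
  have h2 := (Measure.ae_ae_comm (μ := (volume : Measure (Torus d)))
    (ν := (volume : Measure (AddCircle (2 * Real.pi)))) hm).mp (Filter.Eventually.of_forall h1)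
  obtain ⟨s, hs⟩ := h2.exists
  exact (eventually_add_right_iff (volume : Measure (Torus d)) (fun i => θ i • s)
    (p := fun x => ∑ k ∈ S, a k * character k x ≠ 0)).mp hs

/-! ### Functions with finitely many modes -/

lemma HasFinitelyManyModes.add {f g : L2 d} (hf : HasFinitelyManyModes f)
    (hg : HasFinitelyManyModes g) : HasFinitelyManyModes (f + g) := by
  refine (hf.union hg).subset fun k hk => ?_
  by_contra h
  simp only [mem_union, mem_ofPred_eq, not_or, not_not] at h
  exact hk (by rw [coeff_add, h.1, h.2, add_zero])

lemma HasFinitelyManyModes.smul {f : L2 d} (hf : HasFinitelyManyModes f) (c : ℝ) :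
    HasFinitelyManyModes (c • f) :=
  hf.subset fun k hk h => hk (by rw [coeff_smul, h, mul_zero])

lemma hasFinitelyManyModes_zero : HasFinitelyManyModes (0 : L2 d) := by
  simp [HasFinitelyManyModes, coeff_zero]

lemma hasFinitelyManyModes_modeL2 (a : ℂ) (k : Fin d → ℤ) :
    HasFinitelyManyModes (modeL2 a k) := by
  refine (Set.toFinite {k, -k}).subset fun j hj => ?_
  by_contra h
  simp only [mem_insert_iff, mem_singleton_iff, not_or] at h
  exact hj (coeff_modeL2 a k j h.1 h.2)

lemma hasFinitelyManyModes_sum_modeH1 (S : Finset (Fin d → ℤ)) (c : (Fin d → ℤ) → ℂ) :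
    HasFinitelyManyModes (toL2 (∑ k ∈ S, modeH1 (c k) k)) := by
  classical
  induction S using Finset.induction_on with
  | empty => simpa using hasFinitelyManyModes_zero
  | insert k S hk ih =>
    rw [Finset.sum_insert hk, map_add]
    exact (hasFinitelyManyModes_modeL2 _ _).add ih

/-- Nonzero functions with finitely many modes are dense in `H¹`. -/
lemma exists_finitelyManyModes_near (w : H1 d) {ε : ℝ} (hε : 0 < ε) :
    ∃ w' : H1 d, w' ≠ 0 ∧ HasFinitelyManyModes (toL2 w') ∧ ‖w' - w‖ < ε := by
  have h := hasSum_modeH1_of_coeff w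
  obtain ⟨S, hS⟩ := (Metric.tendsto_nhds.mp h (ε / 2) (by linarith)).exists
  rw [dist_eq_norm] at hS
  have hfin := hasFinitelyManyModes_sum_modeH1 S (coeff (toL2 w))
  set f := ∑ k ∈ S, modeH1 (coeff (toL2 w) k) k with hf
  by_cases h0 : f = 0
  -- The partial sum can vanish, for instance when w = 0; a small nonzero constant function then
  -- takes its place.
  · set u : H1 d := modeH1 1 0 with hu
    have hu0 : u ≠ 0 := by
      intro h0
      have h1 : coeff (toL2 u) 0 = 1 := by
        rw [hu, toL2_modeH1, coeff_modeL2_eq]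
        norm_num
      rw [h0, map_zero, coeff_zero] at h1
      exact zero_ne_one h1
    have hr : 0 < ε / (2 * (‖u‖ + 1)) := by positivity
    refine ⟨(ε / (2 * (‖u‖ + 1))) • u, smul_ne_zero hr.ne' hu0, ?_, ?_⟩
    · rw [map_smul]
      exact (hasFinitelyManyModes_modeL2 1 0).smul _
    · rw [h0, zero_sub, norm_neg] at hS
      refine (norm_sub_le _ _).trans_lt ?_
      rw [norm_smul, Real.norm_of_nonneg hr.le]
      have : ε / (2 * (‖u‖ + 1)) * ‖u‖ ≤ ε / 2 := by
        rw [div_mul_eq_mul_div, div_le_div_iff₀ (by positivity) (by norm_num)]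
        nlinarith [norm_nonneg u]
      linarith
  · exact ⟨f, h0, hfin, hS.trans (by linarith)⟩

/-- A function with finitely many modes is almost everywhere a trigonometric polynomial. -/
lemma HasFinitelyManyModes.ae_eq_sum {f : L2 d} (hf : HasFinitelyManyModes f) :
    ∃ S : Finset (Fin d → ℤ), (∀ k, k ∈ S ↔ coeff f k ≠ 0) ∧
      ∀ᵐ x, (f x : ℂ) = ∑ k ∈ S, coeff f k * eigenfunction k x := by
  obtain ⟨S, hS⟩ : ∃ S : Finset (Fin d → ℤ), ∀ k, k ∈ S ↔ coeff f k ≠ 0 :=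
    ⟨Set.Finite.toFinset hf, fun k => Set.Finite.mem_toFinset hf⟩
  refine ⟨S, hS, ?_⟩
  have h1 := (eigenBasis d).hasSum_repr (complexify d f)
  simp only [eigenBasis_repr_complexify, eigenBasis_apply] at h1
  have h2 : HasSum (fun k => coeff f k • eigenfunctionLp k)
      (∑ k ∈ S, coeff f k • eigenfunctionLp k) := by
    refine hasSum_sum_of_ne_finset_zero fun k hk => ?_
    have : coeff f k = 0 := not_not.mp (mt (hS k).mpr hk)
    rw [this, zero_smul]
  have h3 : complexify d f = ContinuousMap.toLp (E := ℂ) 2 volume ℂ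
      (∑ k ∈ S, coeff f k • eigenfunction k) := by
    rw [h1.unique h2, map_sum]
    simp only [map_smul, eigenfunctionLp]
  filter_upwards [coeFn_complexify f, ContinuousMap.coeFn_toLp (𝕜 := ℂ) (p := 2) volume
    (∑ k ∈ S, coeff f k • eigenfunction k)] with x hx hy
  rw [← hx, h3, hy]
  simp

lemma HasFinitelyManyModes.ae_ne_zero {f : L2 d} (hf : HasFinitelyManyModes f) (h0 : f ≠ 0) :
    ∀ᵐ x, f x ≠ 0 := by
  obtain ⟨k₀, hk₀⟩ : ∃ k₀, coeff f k₀ ≠ 0 := by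
    by_contra! h
    exact h0 (coeff_ext fun k => by rw [h, coeff_zero])
  have hs : (modeScale d : ℂ) ≠ 0 := by exact_mod_cast (modeScale_pos d).ne'
  obtain ⟨S, hS, hsum⟩ := hf.ae_eq_sum
  filter_upwards [hsum, ae_sum_character_ne_zero S
    (fun k => coeff f k * modeScale d) (k₀ := k₀) ((hS k₀).mpr hk₀)
    (mul_ne_zero hk₀ hs)] with x hx hy h
  apply hy
  rw [h, Complex.ofReal_zero] at hx
  rw [hx]
  simp only [eigenfunction_apply, mul_assoc]

/-- A continuous representative allows f itself to act as a multiplier through `mulL2`. -/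
lemma HasFinitelyManyModes.exists_continuousMap {f : L2 d} (hf : HasFinitelyManyModes f) :
    ∃ F : C(Torus d, ℝ), ∀ᵐ x, f x = F x := by
  obtain ⟨S, -, hsum⟩ := hf.ae_eq_sum
  refine ⟨⟨fun x => (∑ k ∈ S, coeff f k * eigenfunction k x).re, by fun_prop⟩, ?_⟩
  filter_upwards [hsum] with x hx
  simp only [ContinuousMap.coe_mk, ← hx, Complex.ofReal_re]

/-- The products of a nonzero function with finitely many modes and trigonometric polynomials are
dense in `L²`. -/
lemma HasFinitelyManyModes.exists_mulL2_near {f : L2 d} (hf : HasFinitelyManyModes f) (h0 : f ≠ 0)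
    (v : L2 d) {ε : ℝ} (hε : 0 < ε) :
    ∃ φ ∈ trigPolynomials d, ‖mulL2 φ f - v‖ < ε := by
  let L : C(Torus d, ℝ) →ₗ[ℝ] L2 d :=
    { toFun := fun φ => mulL2 φ f
      map_add' := fun φ ψ => add_mulL2 φ ψ f
      map_smul' := fun c φ => smul_mulL2 c φ f }
  have hL : ∀ φ, L φ = mulL2 φ f := fun _ => rfl
  obtain ⟨F, hF⟩ := hf.exists_continuousMap
  have hdense : ((trigPolynomials d).map L).topologicalClosure = ⊤ := by
    -- If g is orthogonal to every φ f, then all Fourier coefficients of f g vanish, so f g = 0;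
    -- since f is nonzero almost everywhere, g = 0.
    rw [Submodule.topologicalClosure_eq_top_iff, Submodule.eq_bot_iff]
    intro g hg
    have hinner : ∀ a k, inner ℝ (modeL2 a k) (mulL2 F g) = 0 := by
      intro a k
      have hmem : mulL2 (modeFun a k) f ∈ (trigPolynomials d).map L := by
        refine ⟨modeFun a k, ?_, rfl⟩
        rw [modeFun_eq_trigMode]
        exact Submodule.subset_span ⟨(a * modeScale d, k), rfl⟩
      rw [← (Submodule.mem_orthogonal _ _).mp hg _ hmem, L2.inner_def, L2.inner_def]
      refine integral_congr_ae ?_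
      filter_upwards [coeFn_mulL2 F g, coeFn_mulL2 (modeFun a k) f, hF,
        coeFn_modeL2 a k] with x h1 h2 h3 h4
      have h5 : modeFun a k x = (a * eigenfunction k x).re := rfl
      simp only [h1, h2, h3, h4, h5, RCLike.inner_apply, conj_trivial]
      ring
    have hzero : mulL2 F g = 0 := coeff_ext fun k => by
      rw [coeff_eq_inner, hinner, hinner, coeff_zero]
      simp
    refine Lp.ext ?_
    have hz := coeFn_mulL2 F g
    rw [hzero] at hz
    filter_upwards [hz, Lp.coeFn_zero ℝ 2 (volume : Measure (Torus d)), hF,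
      hf.ae_ne_zero h0] with x h1 h2 h3 h4
    rw [h2, Pi.zero_apply, ← h3] at h1
    rw [h2, Pi.zero_apply]
    exact (mul_eq_zero.mp h1.symm).resolve_left h4
  have hv : v ∈ closure (((trigPolynomials d).map L : Submodule ℝ (L2 d)) : Set (L2 d)) := by
    rw [← Submodule.topologicalClosure_coe, hdense]
    trivial
  obtain ⟨_, ⟨φ, hφ, rfl⟩, hlt⟩ := Metric.mem_closure_iff.mp hv ε hε
  exact ⟨φ, hφ, by rwa [dist_comm, dist_eq_norm, hL] at hlt⟩

/-! ### Small-time approximate controllability -/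

lemma SteersTo.of_forall_near {η : ℝ} {V W : State d}
    (h : ∀ ε > 0, ∃ Z, SteersTo η V Z ∧ ‖Z - W‖ < ε) : SteersTo η V W := by
  intro ε hε
  obtain ⟨Z, hZ, hlt⟩ := h (ε / 2) (by linarith)
  obtain ⟨l, hl, ht, hf⟩ := hZ (ε / 2) (by linarith)
  refine ⟨l, hl, ht, ?_⟩
  calc _ ≤ _ := norm_sub_le_norm_sub_add_norm_sub _ Z _
    _ < ε := by linarith

/-- An impulse leaves the profile alone and adds φ w to the velocity, and φ w can be brought
arbitrarily close to v' - v. -/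
lemma steersTo_velocity {w : H1 d} (h0 : w ≠ 0) (hw : HasFinitelyManyModes (toL2 w)) (v v' : L2 d)
    {η : ℝ} (hη : 0 < η) : SteersTo η (w, v) (w, v') := by
  refine SteersTo.of_forall_near fun ε hε => ?_
  obtain ⟨φ, hφ, hlt⟩ := hw.exists_mulL2_near
    (fun h => h0 (toL2_injective (by rw [h, map_zero]))) (v' - v) hε
  refine ⟨_, impulsive_of_mem_trigPolynomials hφ (w, v) η hη, ?_⟩
  have e : ((w, v) : State d) + controlCLM φ (w, v) - (w, v') =
      ((0 : H1 d), mulL2 φ (toL2 w) - (v' - v)) := by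
    rw [controlCLM_apply]
    refine Prod.ext ?_ ?_
    · simp
    · simp only [Prod.snd_sub, Prod.snd_add]
      abel
  rw [e, Prod.norm_mk, norm_zero, max_eq_right (norm_nonneg _)]
  exact hlt

-- For a single frequency the sinc factor tends to 1 as δ → 0. Finiteness of S makes one range of δ
-- work for all frequencies at once.
open Filter Topology in
lemma eventually_sineMultiplier_ne_zero {S : Set (Fin d → ℤ)} (hS : S.Finite) :
    ∀ᶠ δ in 𝓝[>] (0 : ℝ), ∀ k ∈ S, sineMultiplier k δ ≠ 0 := by
  rw [Filter.eventually_all_finite hS]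
  intro k _
  have hc : Continuous fun δ : ℝ => Real.sinc (Real.sqrt (eigenvalue k) * δ) :=
    Real.continuous_sinc.comp (continuous_const.mul continuous_id)
  have h1 : ∀ᶠ δ in 𝓝 (0 : ℝ), Real.sinc (Real.sqrt (eigenvalue k) * δ) ≠ 0 :=
    hc.continuousAt.eventually_ne (by simp)
  filter_upwards [h1.filter_mono nhdsWithin_le_nhds, self_mem_nhdsWithin] with δ hδ hpos
  exact mul_ne_zero (ne_of_gt hpos) hδ

open Filter Topology in
/-- Between profiles with finitely many modes the free evolution can be steered exactly by the
choice of the initial velocity. -/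
lemma eventually_exists_velocity {w w' : H1 d} (hw : HasFinitelyManyModes (toL2 w))
    (hw' : HasFinitelyManyModes (toL2 w')) :
    ∀ᶠ δ in 𝓝[>] (0 : ℝ), ∃ v : L2 d, (freeCLM δ (w, v)).1 = w' := by
  filter_upwards [eventually_sineMultiplier_ne_zero (hw.union hw')] with δ hδ
  -- Obtained by solving the profile equation for the velocity in each mode. Outside the two finite
  -- supports the numerator is zero, so c vanishes there even if the divisor does.
  let c : (Fin d → ℤ) → ℂ := fun k =>
    (coeff (toL2 w') k - cosMultiplier k δ * coeff (toL2 w) k) / sineMultiplier k δ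
  have hout : ∀ k, k ∉ {k | coeff (toL2 w) k ≠ 0} ∪ {k | coeff (toL2 w') k ≠ 0} →
      coeff (toL2 w) k = 0 ∧ coeff (toL2 w') k = 0 := fun k hk => by
    simpa [not_or] using hk
  have hc : IsHermitianSeq c := fun k => by
    simp [c, coeff_neg_index, cosMultiplier_neg_index, sineMultiplier_neg_index]
  have hs : Summable fun k => ‖c k‖ ^ 2 := by
    refine summable_of_ne_finset_zero (s := (hw.union hw').toFinset) fun k hk => ?_
    obtain ⟨h1, h2⟩ := hout k (by simpa using hk)
    simp [c, h1, h2]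
  obtain ⟨v, -, hv⟩ := exists_hasSum_modeL2 hc hs
  refine ⟨v, H1.coeff_ext fun k => ?_⟩
  rw [freeCLM_apply, coeff_freeEvolution_fst, profileCoeff]
  simp only [hv, c]
  by_cases hk : k ∈ {k | coeff (toL2 w) k ≠ 0} ∪ {k | coeff (toL2 w') k ≠ 0}
  · have : (sineMultiplier k δ : ℂ) ≠ 0 := by exact_mod_cast hδ k hk
    field_simp
    ring
  · obtain ⟨h1, h2⟩ := hout k hk
    simp [h1, h2]

open Filter Topology in
lemma steersTo_of_profile {w : H1 d} (h0 : w ≠ 0) (hw : HasFinitelyManyModes (toL2 w)) (v : L2 d)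
    (W : State d) {η : ℝ} (hη : 0 < η) : SteersTo η (w, v) W := by
  refine SteersTo.of_forall_near fun ε hε => ?_
  -- The intermediate profile must have finitely many modes to be reached freely, and must be
  -- nonzero for the final velocity correction to be possible.
  obtain ⟨w', hw'0, hw', hlt⟩ := exists_finitelyManyModes_near W.1 hε
  refine ⟨(w', W.2), ?_, ?_⟩
  · obtain ⟨δ, ⟨u, hu⟩, hδ⟩ := ((eventually_exists_velocity hw hw').and
      (Ioo_mem_nhdsGT (show (0 : ℝ) < η / 3 by linarith))).exists
    have h1 := steersTo_velocity h0 hw v u (show 0 < η / 3 by linarith)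
    have h2 := SteersTo.free hδ.1 hδ.2 (w, u)
    have e : freeCLM δ (w, u) = (w', (freeCLM δ (w, u)).2) := Prod.ext hu rfl
    rw [e] at h2
    have h := (h1.trans h2).trans
      (steersTo_velocity hw'0 hw' _ W.2 (show 0 < η / 3 by linarith))
    rwa [add_thirds] at h
  · have e : ((w', W.2) : State d) - W = (w' - W.1, 0) := Prod.ext rfl (sub_self _)
    rw [e, Prod.norm_mk, norm_zero, max_eq_left (norm_nonneg _)]
    exact hlt

-- Impulses have no effect on a zero profile, so the velocity must first act freely. The resulting
-- profile inherits the modes of v, none of them killed when δ is small.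
open Filter Topology in
lemma eventually_profile_of_velocity {v : L2 d} (h0 : v ≠ 0) (hv : HasFinitelyManyModes v) :
    ∀ᶠ δ in 𝓝[>] (0 : ℝ), (freeCLM δ ((0 : H1 d), v)).1 ≠ 0 ∧
      HasFinitelyManyModes (toL2 (freeCLM δ ((0 : H1 d), v)).1) := by
  obtain ⟨k₀, hk₀⟩ : ∃ k₀, coeff v k₀ ≠ 0 := by
    by_contra! h
    exact h0 (coeff_ext fun k => by rw [h, coeff_zero])
  filter_upwards [eventually_sineMultiplier_ne_zero hv] with δ hδ
  have hc : ∀ k, coeff (toL2 (freeCLM δ ((0 : H1 d), v)).1) k =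
      sineMultiplier k δ * coeff v k := fun k => by
    rw [freeCLM_apply, coeff_freeEvolution_fst, profileCoeff]
    simp [coeff_zero]
  refine ⟨fun h => ?_, hv.subset fun k hk h => hk (by rw [hc, h, mul_zero])⟩
  have := hc k₀
  rw [h, map_zero, coeff_zero, eq_comm, mul_eq_zero] at this
  exact this.elim (fun h => hδ k₀ hk₀ (by exact_mod_cast h)) hk₀

open Filter Topology in
lemma steersTo_of_velocity {v : L2 d} (h0 : v ≠ 0) (hv : HasFinitelyManyModes v) (W : State d)
    {η : ℝ} (hη : 0 < η) : SteersTo η ((0 : H1 d), v) W := by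
  obtain ⟨δ, ⟨hne, hfin⟩, hδ⟩ := ((eventually_profile_of_velocity h0 hv).and
    (Ioo_mem_nhdsGT (show (0 : ℝ) < η / 2 by linarith))).exists
  have h := (SteersTo.free hδ.1 hδ.2 ((0 : H1 d), v)).trans
    (steersTo_of_profile hne hfin (freeCLM δ ((0 : H1 d), v)).2 W
      (show 0 < η / 2 by linarith))
  rwa [add_halves] at h

/-! ### From arbitrarily small times to the prescribed time -/

lemma stateNorm_le (W : State d) : stateNorm W ≤ 2 * ‖W‖ := by
  rw [stateNorm, Real.sqrt_le_left (by positivity)]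
  have h1 := pow_le_pow_left₀ (norm_nonneg _) (norm_fst_le W) 2
  have h2 := pow_le_pow_left₀ (norm_nonneg _) (norm_snd_le W) 2
  nlinarith [sq_nonneg ‖W‖]

lemma isSolution_iff {T : ℝ} {p : ℝ → Fin (2 * d + 1) → ℝ} {W₀ : State d} {W : ℝ → State d} :
    IsSolution T p W₀ W ↔
      IsMildSolution freeCLM (fun s => controlCLM (potential (p s))) T W₀ W := Iff.rfl

/-- If every state can be approximated in arbitrarily small time, then it can be approximated at
any prescribed time. -/
lemma exists_control_of_steersTo {V : State d} (hV : ∀ W η, 0 < η → SteersTo η V W) (Z : State d)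
    {ε T : ℝ} (hε : 0 < ε) (hT : 0 < T) :
    ∃ l : List (ℝ × (Fin (2 * d + 1) → ℝ)), (∀ e ∈ l, 0 < e.1) ∧ listTime l = T ∧
      ‖listFlow freeCLM (fun c => controlCLM (potential c)) l V - Z‖ < ε := by
  -- If the backward evolution of Z is reached at a small time t, the free evolution for the
  -- remaining T - t ends near Z by strong continuity.
  have hc : Continuous fun t => freeCLM (T - t) (freeCLM (-T) Z) :=
    (continuous_freeCLM_apply _).comp (continuous_const.sub continuous_id)
  obtain ⟨ρ, hρ, hclose⟩ := Metric.continuousAt_iff.mp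
    (hc.continuousAt (x := (0 : ℝ))) (ε / 2) (by linarith)
  rw [sub_zero, ← freeCLM_add, add_neg_cancel, freeCLM_zero] at hclose
  have hM : 0 < 2 + 2 * T := by linarith
  -- 2 + 2T bounds the norm of the free evolution over the remaining time, which amplifies the error
  -- made so far.
  obtain ⟨l, hl, ht, hf⟩ := hV (freeCLM (-T) Z) (min ρ T) (lt_min hρ hT) (ε / (2 * (2 + 2 * T)))
    (by positivity)
  have ht0 := listTime_nonneg hl
  have htT : 0 < T - listTime l := by linarith [min_le_right ρ T]
  refine ⟨l ++ [(T - listTime l, 0)], fun e he => ?_, ?_, ?_⟩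
  · rcases List.mem_append.mp he with h | h
    · exact hl e h
    · rw [List.mem_singleton.mp h]
      exact htT
  · rw [listTime_append]
    simp [listTime]
  · rw [listFlow_append]
    set Y := listFlow freeCLM (fun c => controlCLM (potential c)) l V with hY
    have e : listFlow freeCLM (fun c : Fin (2 * d + 1) → ℝ => controlCLM (potential c))
        [(T - listTime l, 0)] Y = freeCLM (T - listTime l) Y := by
      simp only [listFlow, potential_zero, controlCLM_zero]
      exact mildFlow_zero isStronglyContinuousGroup_freeCLM htT.le Y
    rw [e]
    have h1 : ‖freeCLM (T - listTime l) (freeCLM (-T) Z) - Z‖ < ε / 2 := by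
      have := hclose (x := listTime l) (by
        rw [Real.dist_eq, sub_zero, abs_of_nonneg ht0]
        linarith [min_le_left ρ T])
      rwa [dist_eq_norm] at this
    have h2 : ‖freeCLM (T - listTime l) Y - freeCLM (T - listTime l) (freeCLM (-T) Z)‖ <
        ε / 2 := by
      rw [← map_sub]
      calc ‖freeCLM (T - listTime l) (Y - freeCLM (-T) Z)‖
          ≤ (2 + 2 * |T - listTime l|) * ‖Y - freeCLM (-T) Z‖ := norm_freeEvolution_le _ _
        _ ≤ (2 + 2 * T) * ‖Y - freeCLM (-T) Z‖ := by
            gcongr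
            rw [abs_of_pos htT]
            linarith
        _ < (2 + 2 * T) * (ε / (2 * (2 + 2 * T))) := by gcongr
        _ = ε / 2 := by field_simp
    calc _ ≤ _ := norm_sub_le_norm_sub_add_norm_sub _
          (freeCLM (T - listTime l) (freeCLM (-T) Z)) _
      _ < ε := by linarith

end BilinearWave

end

theorem theorem1 (d : ℕ) (w₀ : H1 d) (v₀ : L2 d) (hne : (w₀, v₀) ≠ ((0, 0) : State d))
    (hinit : (w₀ ≠ 0 ∧ HasFinitelyManyModes (toL2 w₀)) ∨
      (w₀ = 0 ∧ v₀ ≠ 0 ∧ HasFinitelyManyModes v₀))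
    (w₁ : H1 d) (v₁ : L2 d) (ε T : ℝ) (hε : 0 < ε) (hT : 0 < T) :
    ∃ p : ℝ → Fin (2 * d + 1) → ℝ, IsPiecewiseConstant T p ∧
      ∃ W : ℝ → State d, IsSolution T p (w₀, v₀) W ∧
        (∀ W' : ℝ → State d, IsSolution T p (w₀, v₀) W' → Set.EqOn W' W (Set.Icc 0 T)) ∧
        stateNorm (W T - (w₁, v₁)) < ε := by
  have hreach : ∀ W η, 0 < η → SteersTo η (w₀, v₀) W := by
    intro W η hη
    rcases hinit with ⟨h0, hw⟩ | ⟨rfl, h0, hv⟩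
    · exact steersTo_of_profile h0 hw v₀ W hη
    · exact steersTo_of_velocity h0 hv W hη
  -- Half of ε, because `stateNorm` is at most twice the maximum norm.
  obtain ⟨l, hl, ht, hf⟩ := exists_control_of_steersTo hreach (w₁, v₁)
    (show 0 < ε / 2 by linarith) hT
  obtain ⟨W, hW, hWT⟩ := exists_isMildSolution_listControl isStronglyContinuousGroup_freeCLM
    (fun c => controlCLM (potential c)) 0 l hl (w₀, v₀)
  -- The uniform bound on the control operators is what the Grönwall argument for uniqueness needs.
  obtain ⟨κ, hκ⟩ := exists_norm_listControl_le (fun c => controlCLM (potential c)) 0 l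
  rw [ht] at hW hWT
  refine ⟨listControl 0 l, ht ▸ isPiecewiseConstant_listControl 0 l hl, W, isSolution_iff.mpr hW,
    fun W' hW' => ?_, ?_⟩
  · exact (isSolution_iff.mp hW').eqOn isStronglyContinuousGroup_freeCLM hT.le hκ hW
  · rw [hWT]
    refine (stateNorm_le _).trans_lt ?_
    linarith
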